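/- Consider a single class switched queueing network with a finite set $\mathcal J$ of queues, operating in discrete time. Let $\mathcal S\subset\mathbb Z_+^{\mathcal J}$ be a set of schedules such that $\sigma\in\mathcal S$, $\sigma'\in\mathbb Z_+^{\mathcal J}$ and $\sigma'\le\sigma$ imply $\sigma'\in\mathcal S$. The numbers of external arrivals at queue $j$ in successive time units are i.i.d. with finite mean $a_j\ge 0$; each unit of work devoted to queue $j$ completes the service of a job with probability $p_j\in(0,1]$ (geometric job sizes); a job served at $j$ moves to queue $j'$ with probability $P_{jj'}$ and leaves the network with probability $1-\sum_{j'}P_{jj'}$, where $P=(P_{jj'})$ is an arbitrary nonnegative matrix with row sums at most $1$ such that $I-P$ is invertible. The arrivals, service completions and routing decisions are all independent of each other. Put $\lambda=a(I-P)^{-1}$ and $\rho_j=\lambda_j/p_j$, and let $\mathcal C$ be the interior (in $\mathbb R^{\mathcal J}$) of the convex hull of $\mathcal S$. For $t\in\mathbb Z_+$ the queue lengths $Q(t)=(Q_j(t))_{j\in\mathcal J}$ satisfy $$Q_j(t)=Q_j(0)+A_j(t)-D_j(t),\qquad A_j(t)=E_j(t)+\sum_{j'}\Phi_{j'j}(D_{j'}(t)),\qquad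 D_j(t)=S_j(\Pi_j(t)),$$ $$\Pi_j(t)=\sum_{\tau=0}^{t-1}\pi_j(Q(\tau))\wedge Q_j(\tau),$$ where $E_j(t)$ is the number of external arrivals at $j$ in the first $t$ time units, $S_j(u)$ is the number of jobs completed at $j$ by the first $u$ units of work devoted to $j$, $\Phi_{j'j}(d)$ is the number of the first $d$ departures from $j'$ that are routed to $j$, and $\pi(Q(\tau))$ is the schedule used at time $\tau$. Under the weighted MaxWeight policy, $\pi(Q)$ is a solution $\sigma$ of $$\text{maximize}\quad \sum_{j\in\mathcal J}Q_j\frac{\sigma_j}{\rho_j}\quad\text{over }\sigma\in\mathcal S ;$$ ties are broken arbitrarily or at random (as a function of $Q$ and of randomness that is i.i.d. over time and independent of the rest). Then $(Q(t))_{t\in\mathbb Z_+}$ is a Markov chain on $\mathbb Z_+^{\mathcal J}$. **Theorem.** If $\rho\in\mathcal C$, then, for any such network under the weighted MaxWeight policy, the queueing network process $(Q(t))_{t\in\mathbb Z_+}$ is positive recurrent. (For an irreducible chain this means that every state has finite mean return time. In general it means that every state in a closed communicating class has finite mean return time, and that there is a finite set of such states that is reached in finite mean time from every initial state.) -/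

import Mathlib

open MeasureTheory ProbabilityTheory
open scoped ENNReal

/-- The parameters of a single class switched queueing network with a finite set `J` of queues. -/
structure SwitchedNetwork (J : Type*) [Fintype J] [DecidableEq J] where
  /-- the set of feasible schedules -/
  schedules : Set (J → ℕ)
  /-- a vector of nonnegative integers below a feasible schedule is a feasible schedule -/
  schedules_lower : ∀ σ ∈ schedules, ∀ σ' : J → ℕ, σ' ≤ σ → σ' ∈ schedules
  /-- the law of the number of external arrivals at a queue in one unit of time -/
  arrivalLaw : J → PMF ℕ
  /-- the mean number of external arrivals is finite -/
  arrival_integrable : ∀ j, Integrable (fun n : ℕ => (n : ℝ)) (arrivalLaw j).toMeasure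
  /-- the parameter of the geometric job sizes at a queue -/
  p : J → ℝ
  p_pos : ∀ j, 0 < p j
  p_le_one : ∀ j, p j ≤ 1
  /-- the mean routing matrix -/
  P : Matrix J J ℝ
  P_nonneg : ∀ i j, 0 ≤ P i j
  P_row_sum_le : ∀ i, ∑ j, P i j ≤ 1
  /-- the network is open -/
  isOpenNetwork : IsUnit (1 - P)

namespace SwitchedNetwork

/-- The index set of the independent random elements that drive the network. -/
inductive PrimitiveIndex (J : Type*) where
  | arrival (j : J) (t : ℕ)
  | service (j : J) (u : ℕ)
  | routing (j : J) (d : ℕ)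
  | rule (t : ℕ)

variable {J : Type*} [Fintype J] [DecidableEq J]

section Intensity

variable (N : SwitchedNetwork J)

/-- The mean number `a j` of external arrivals at queue `j` per unit of time. -/
noncomputable def meanArrival (j : J) : ℝ := ∫ n : ℕ, (n : ℝ) ∂(N.arrivalLaw j).toMeasure

/-- The total arrival rate `λ = a (I - P)⁻¹`. -/
noncomputable def totalArrivalRate : J → ℝ := Matrix.vecMul N.meanArrival (1 - N.P)⁻¹

/-- The traffic intensity `ρ j = λ j / p j`. -/
noncomputable def trafficIntensity (j : J) : ℝ := N.totalArrivalRate j / N.p j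

/-- The subcritical region: the interior of the convex hull of the set of schedules. -/
def subcriticalRegion : Set (J → ℝ) :=
  interior (convexHull ℝ ((fun (σ : J → ℕ) (j : J) => (σ j : ℝ)) '' N.schedules))

/-- `σ` solves the weighted MaxWeight problem for the queue length vector `q`: it maximizes
`∑ j, q j * (σ j / ρ j)` over the set of schedules. -/
def IsWeightedMaxWeightSchedule (q σ : J → ℕ) : Prop :=
  IsMaxOn (fun s : J → ℕ => ∑ j, (q j : ℝ) * ((s j : ℝ) / N.trafficIntensity j)) N.schedules σ ∧
    σ ∈ N.schedules

end Intensity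

/-- The random elements that drive the network, as functions on a sample space `Ω`. -/
structure Primitives (J : Type*) (Ω : Type*) where
  /-- number of external arrivals at queue `j` between times `t` and `t + 1` -/
  arrival : J → ℕ → Ω → ℕ
  /-- whether the unit of work number `u` (counted from 0) spent at queue `j` completes a job -/
  service : J → ℕ → Ω → Bool
  /-- where the departure number `d` (counted from 0) from queue `j` goes; `none` means that
  the job leaves the network -/
  routing : J → ℕ → Ω → Option J
  /-- the scheduling rule at time `t`: the schedule chosen at that time as a function of the
  queue length vector (a random function, since ties may be broken at random) -/
  rule : ℕ → Ω → (J → ℕ) → (J → ℕ)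

namespace Primitives

variable {Ω : Type*}

/-- The σ-algebra on `Ω` generated by one of the random elements. -/
@[reducible] def sigma (X : Primitives J Ω) : PrimitiveIndex J → MeasurableSpace Ω
  | .arrival j t => MeasurableSpace.comap (X.arrival j t) ⊤
  | .service j u => MeasurableSpace.comap (X.service j u) ⊤
  | .routing j d => MeasurableSpace.comap (X.routing j d) ⊤
  | .rule t => MeasurableSpace.comap (X.rule t) inferInstance

/-- The random elements are independent and have the laws prescribed by the network: the arrivals
at queue `j` are i.i.d. with law `arrivalLaw j`; each unit of work at queue `j` completes a job with
probability `p j`, so that the numbers of units of work that jobs require are i.i.d. geometric;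
a departure from `j` is routed to `j'` with probability `P j j'` (and leaves the network with the
remaining probability); the scheduling rules at different times are i.i.d. -/
structure IsDriving (X : Primitives J Ω) (N : SwitchedNetwork J) [mΩ : MeasurableSpace Ω]
    (μ : Measure Ω) : Prop where
  measurable : ∀ i, X.sigma i ≤ mΩ
  indep : iIndep X.sigma μ
  arrival_law : ∀ j t, μ.map (X.arrival j t) = (N.arrivalLaw j).toMeasure
  service_law : ∀ j u, μ {ω | X.service j u ω = true} = ENNReal.ofReal (N.p j)
  routing_law : ∀ j d j', μ {ω | X.routing j d ω = some j'} = ENNReal.ofReal (N.P j j')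
  rule_law : ∀ t, μ.map (X.rule t) = μ.map (X.rule 0)

/-- The policy is weighted MaxWeight: for every queue length vector, the chosen schedule almost
surely solves the weighted MaxWeight problem. Ties may be broken arbitrarily or randomly. -/
def IsWeightedMaxWeightPolicy (X : Primitives J Ω) (N : SwitchedNetwork J) [MeasurableSpace Ω]
    (μ : Measure Ω) : Prop :=
  ∀ t q, ∀ᵐ ω ∂μ, N.IsWeightedMaxWeightSchedule q (X.rule t ω q)

section Equations

variable (X : Primitives J Ω) (ω : Ω)

/-- `E j t`: cumulative number of external arrivals at queue `j` by time `t`. -/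
def cumArrival (j : J) (t : ℕ) : ℕ := ∑ s ∈ Finset.range t, X.arrival j s ω

/-- `S j u`: number of jobs served after `u` units of service are devoted to queue `j`. -/
def cumServed (j : J) (u : ℕ) : ℕ := ((Finset.range u).filter fun k => X.service j k ω = true).card

/-- `Φ j j' d`: number of jobs routed from `j` to `j'` after `d` departures from `j`. -/
def cumRouted (j j' : J) (d : ℕ) : ℕ :=
  ((Finset.range d).filter fun k => X.routing j k ω = some j').card

/-- `Π j t`: cumulative service at queue `j` by time `t` along a trajectory `q` of queue length
vectors. -/
def cumWork (q : ℕ → J → ℕ) (j : J) (t : ℕ) : ℕ :=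
  ∑ τ ∈ Finset.range t, min (X.rule τ ω (q τ) j) (q τ j)

/-- `D j t = S j (Π j t)`: cumulative number of departures from queue `j`. -/
def departures (q : ℕ → J → ℕ) (j : J) (t : ℕ) : ℕ := X.cumServed ω j (X.cumWork ω q j t)

/-- `A j t = E j t + ∑ j', Φ j' j (D j' t)`: cumulative number of external and internal arrivals
at queue `j`. -/
def totalArrivals (q : ℕ → J → ℕ) (j : J) (t : ℕ) : ℕ :=
  X.cumArrival ω j t + ∑ j', X.cumRouted ω j' j (X.departures ω q j' t)

end Equations

/-- `Q` is the queueing network process with initial state `x`: it satisfies the queueing network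
equation `Q j t = Q j 0 + A j t - D j t`. -/
structure IsQueueingNetworkSolution (X : Primitives J Ω) (x : J → ℕ) (Q : ℕ → Ω → J → ℕ) : Prop where
  init : ∀ ω, Q 0 ω = x
  balance : ∀ t ω j, (Q t ω j : ℤ) =
    (x j : ℤ) + X.totalArrivals ω (fun s => Q s ω) j t - X.departures ω (fun s => Q s ω) j t

end Primitives

end SwitchedNetwork

section PositiveRecurrence

variable {α Ω : Type*}

/-- The first time `t ≥ 1` at which the trajectory is in the set `A` (`∞` if there is none). -/
noncomputable def returnTime (q : ℕ → α) (A : Set α) : ℝ≥0∞ :=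
  ⨅ (t : ℕ) (_ : 1 ≤ t ∧ q t ∈ A), (t : ℝ≥0∞)

variable [MeasurableSpace Ω] (μ : Measure Ω) (Q : α → ℕ → Ω → α)

/-- The mean of the first time `t ≥ 1` at which the process started at `x` is in the set `A`.
Here `Q x` is the process started at `x`. -/
noncomputable def meanReturnTime (x : α) (A : Set α) : ℝ≥0∞ :=
  ∫⁻ ω, returnTime (fun t => Q x t ω) A ∂μ

/-- The state `y` is accessible from the state `x`. -/
def IsAccessible (x y : α) : Prop := ∃ t, 0 < μ {ω | Q x t ω = y}

/-- A state is essential if it is accessible from every state that is accessible from it. Essential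
states are those in closed communicating classes; in an irreducible chain every state is. -/
def IsEssential (x : α) : Prop := ∀ y, IsAccessible μ Q x y → IsAccessible μ Q y x

/-- Positive recurrence of a time-homogeneous Markov chain `Q` on a countable state space, given by
its versions `Q x` started at the different states `x`. For an irreducible chain this says that
the mean return time of every state is finite. In general, inessential states (which are
always transient) may exist, and then essential states have finite mean return times,
and from every initial state the chain enters a certain finite set of essential states in finite
mean time. -/
structure IsPositiveRecurrent : Prop where
  essential : ∀ x, IsEssential μ Q x → meanReturnTime μ Q x {x} < ∞
  absorbed : ∃ F : Set α, F.Finite ∧ (∀ y ∈ F, IsEssential μ Q y) ∧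
    ∀ x, meanReturnTime μ Q x F < ∞

end PositiveRecurrence

/-! Write y(σ) = σ/ρ - 1 for the excess of a schedule. By the traffic equation, serving according to
σ moves the mean queue lengths with velocity -(λ_j y_j - ∑_i λ_i y_i P_ij), so a Lyapunov function
with gradient v falls at rate `driftForm v y`. Weighted MaxWeight maximizes q·y(σ), and the natural
candidate is g(q) = max_σ q·y(σ), which exceeds a positive multiple of ∑ q_j because ρ is interior
(`exists_excess_ge`). Where the maximizer is unique the gradient of g is y(σ) itself, and `driftForm
y y` is positive for y ≠ 0, being half a sum of squares (`driftForm_self_pos`).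

The difficulty is at ties and near ties, where several schedules F are used in unknown proportions:
one vector v must have positive drift against every member of F. The matrix game with payoffs
`driftForm (y σ) (y τ)` on F is strictly copositive, hence has positive value, and an optimal
mixture α_F of the y(σ) is such a v (`exists_fullSupport_strategy`). The Lyapunov function is V(q) =
max_F (v_F·q + M(|F|)); the bonuses M grow so fast that a maximizing F contains every schedule
within η of optimal (`exists_bonus`). The decrease δ and the gradient bound C do not depend on η
(`exists_lyapunov`).

The stochastic argument compares times 0 and T. As V is a maximum of affine functions, its increment
is at most v·(Q(T) - Q(0)) with v a subgradient at the end point Q(T). Unless arrivals are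
exceptionally numerous, every schedule used before T is within η of optimal for Q(T), so each time
step contributes at most -δ (`lyapunov_sub_le`). The vector v depends on the randomness, but it is
bounded by C, so it suffices that the absolute deviations from mean behaviour are o(T) in
expectation, which follows from laws of large numbers.

A multistep Foster criterion then gives finite mean hitting times of a finite set, and a general
argument about countable chains turns this into positive recurrence without irreducibility. The
Markov property holds because the unused primitives are independent of the past and distributed like
the whole family. -/

set_option linter.unusedSectionVars false

/-! ### Mean return times and Foster's criterion for countable Markov chains -/

section MarkovChain

variable {α Ω : Type*} [MeasurableSpace Ω]

/-- The processes `Q x` are versions, started at the different states `x`, of one time-homogeneous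
Markov chain. -/
structure IsMarkovChain [MeasurableSpace α] (μ : Measure Ω) (Q : α → ℕ → Ω → α) : Prop where
  measurable : ∀ x t, Measurable (Q x t)
  init : ∀ x ω, Q x 0 ω = x
  markov : ∀ x t (h : ℕ → α) y,
    μ {ω | (∀ s ≤ t, Q x s ω = h s) ∧ Q x (t + 1) ω = y} =
      μ {ω | ∀ s ≤ t, Q x s ω = h s} * μ {ω | Q (h t) 1 ω = y}

/-- The transition operator of the chain, killed on entering `G`. -/
noncomputable def killedOp (μ : Measure Ω) (Q : α → ℕ → Ω → α) (G : Set α) (f : α → ℝ≥0∞)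
    (x : α) : ℝ≥0∞ :=
  ∫⁻ ω, Gᶜ.indicator f (Q x 1 ω) ∂μ

/-- The trajectory `q` avoids `G` at the times `1, …, n`. -/
def AvoidsUpTo (q : ℕ → α) (G : Set α) (n : ℕ) : Prop := ∀ s, 1 ≤ s → s ≤ n → q s ∉ G

/-- Tail summation: a time r ≥ 1 is the number of n < r. The index n = 0 always counts, since the
starting position is disregarded; if `G` is never entered both sides are infinite. -/
theorem returnTime_eq_tsum (q : ℕ → α) (G : Set α) :
    returnTime q G = ∑' n, Set.indicator {n | AvoidsUpTo q G n} (fun _ => (1 : ℝ≥0∞)) n := by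
  classical
  by_cases h : ∃ t, 1 ≤ t ∧ q t ∈ G
  · have hm := Nat.find_spec h
    have hset : {n | AvoidsUpTo q G n} = (Finset.range (Nat.find h) : Set ℕ) := by
      ext n
      simp only [Set.mem_ofPred_eq, Finset.coe_range, Set.mem_Iio]
      constructor
      · intro hn
        by_contra hlt
        exact hn _ hm.1 (not_lt.mp hlt) hm.2
      · intro hn s hs hsn hq
        exact Nat.find_min h (lt_of_le_of_lt hsn hn) ⟨hs, hq⟩
    have hr : returnTime q G = (Nat.find h : ℝ≥0∞) := by
      apply le_antisymm
      · exact iInf₂_le (f := fun (t : ℕ) (_ : 1 ≤ t ∧ q t ∈ G) => (t : ℝ≥0∞)) _ hm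
      · refine le_iInf₂ fun t ht => ?_
        exact_mod_cast Nat.find_min' h ht
    rw [hr, hset, tsum_eq_sum (s := Finset.range (Nat.find h))]
    · rw [Finset.sum_congr rfl fun b hb => Set.indicator_of_mem (Finset.mem_coe.mpr hb) _]
      simp
    · intro b hb
      exact Set.indicator_of_notMem (by simpa using hb) _
  · have hset : {n | AvoidsUpTo q G n} = Set.univ := by
      ext n
      simp only [Set.mem_ofPred_eq, Set.mem_univ, iff_true]
      intro s hs _ hq
      exact h ⟨s, hs, hq⟩
    have hr : returnTime q G = ∞ := by
      simp only [returnTime, iInf_eq_top]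
      intro t ht
      exact absurd ⟨t, ht⟩ h
    rw [hr, hset]
    simp

section Operator

variable {μ : Measure Ω} {Q : α → ℕ → Ω → α} {G : Set α}

theorem killedOp_mono {f g : α → ℝ≥0∞} (h : ∀ x, x ∉ G → f x ≤ g x) (x : α) :
    killedOp μ Q G f x ≤ killedOp μ Q G g x := by
  refine lintegral_mono fun ω => ?_
  by_cases hG : Q x 1 ω ∈ G
  · simp [hG]
  · simpa [hG] using h _ hG

theorem killedOp_empty (f : α → ℝ≥0∞) (x : α) :
    killedOp μ Q ∅ f x = ∫⁻ ω, f (Q x 1 ω) ∂μ := by simp [killedOp]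

theorem killedOp_le_killedOp_empty (f : α → ℝ≥0∞) (x : α) :
    killedOp μ Q G f x ≤ killedOp μ Q ∅ f x := by
  rw [killedOp_empty]
  exact lintegral_mono fun ω => Set.indicator_le_self _ _ _

variable [MeasurableSpace α] [DiscreteMeasurableSpace α]

theorem measurable_discrete_comp {β : Type*} [MeasurableSpace β] {g : Ω → α} (hg : Measurable g)
    (f : α → β) : Measurable fun ω => f (g ω) :=
  Measurable.of_discrete.comp hg

variable (hQ : ∀ x t, Measurable (Q x t))
include hQ

theorem killedOp_add (f g : α → ℝ≥0∞) (x : α) :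
    killedOp μ Q G (fun y => f y + g y) x = killedOp μ Q G f x + killedOp μ Q G g x := by
  rw [killedOp, killedOp, killedOp, ← lintegral_add_left (measurable_discrete_comp (hQ x 1) _)]
  congr 1; ext ω
  exact congrFun (Set.indicator_add Gᶜ f g) _

theorem killedOp_const_mul (c : ℝ≥0∞) (f : α → ℝ≥0∞) (x : α) :
    killedOp μ Q G (fun y => c * f y) x = c * killedOp μ Q G f x := by
  rw [killedOp, killedOp, ← lintegral_const_mul c (measurable_discrete_comp (hQ x 1) _)]
  congr 1; ext ω
  by_cases h : Q x 1 ω ∈ G <;> simp [h]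

theorem killedOp_tsum (f : ℕ → α → ℝ≥0∞) (x : α) :
    killedOp μ Q G (fun y => ∑' n, f n y) x = ∑' n, killedOp μ Q G (f n) x := by
  simp only [killedOp]
  rw [← lintegral_tsum fun n => (measurable_discrete_comp (hQ x 1) (Gᶜ.indicator (f n))).aemeasurable]
  congr 1; ext ω
  by_cases h : Q x 1 ω ∈ G <;> simp [h]

theorem killedOp_sum {ι : Type*} (s : Finset ι) (f : ι → α → ℝ≥0∞) (x : α) :
    killedOp μ Q G (fun y => ∑ i ∈ s, f i y) x = ∑ i ∈ s, killedOp μ Q G (f i) x := by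
  simp only [killedOp]
  rw [← lintegral_finsetSum _ fun n _ => measurable_discrete_comp (hQ x 1) (Gᶜ.indicator (f n))]
  congr 1; ext ω
  by_cases h : Q x 1 ω ∈ G <;> simp [h]

omit hQ [MeasurableSpace α] [DiscreteMeasurableSpace α] in
theorem killedOp_iterate_succ (f : α → ℝ≥0∞) (n : ℕ) :
    (killedOp μ Q G)^[n + 1] f = killedOp μ Q G ((killedOp μ Q G)^[n] f) :=
  Function.iterate_succ_apply' _ _ _

end Operator

namespace IsMarkovChain

variable [Countable α] [MeasurableSpace α] [DiscreteMeasurableSpace α]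
  {μ : Measure Ω} [IsProbabilityMeasure μ] {Q : α → ℕ → Ω → α} (hQ : IsMarkovChain μ Q)
include hQ

/-- The Markov property, for functions of the history. -/
theorem lintegral_history_mul (x : α) (t : ℕ) (F : (Fin (t + 1) → α) → ℝ≥0∞) (f : α → ℝ≥0∞) :
    ∫⁻ ω, F (fun s => Q x s ω) * f (Q x (t + 1) ω) ∂μ =
      ∫⁻ ω, F (fun s => Q x s ω) * ∫⁻ ω', f (Q (Q x t ω) 1 ω') ∂μ ∂μ := by
  have hH : Measurable fun ω => (fun s : Fin (t + 1) => Q x s ω) :=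
    measurable_pi_lambda _ fun s => hQ.measurable x s
  have h1 : ∫⁻ ω, F (fun s => Q x s ω) * f (Q x (t + 1) ω) ∂μ =
      ∑' h : Fin (t + 1) → α, ∑' y : α, F h * f y *
        μ {ω | (fun s : Fin (t + 1) => Q x s ω) = h ∧ Q x (t + 1) ω = y} := by
    have hp := hH.prodMk (hQ.measurable x (t + 1))
    rw [← ENNReal.tsum_prod]
    have := lintegral_map (μ := μ) (f := fun p : (Fin (t + 1) → α) × α => F p.1 * f p.2)
      Measurable.of_discrete hp
    rw [← this, lintegral_countable']
    congr 1; ext p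
    rw [Measure.map_apply hp (measurableSet_singleton _)]
    congr 2; ext ω
    simp [Prod.ext_iff]
  have h2 : ∫⁻ ω, F (fun s => Q x s ω) * ∫⁻ ω', f (Q (Q x t ω) 1 ω') ∂μ ∂μ =
      ∑' h : Fin (t + 1) → α, F h * (∫⁻ ω', f (Q (h (Fin.last t)) 1 ω') ∂μ) *
        μ {ω | (fun s : Fin (t + 1) => Q x s ω) = h} := by
    have := lintegral_map (μ := μ) (f := fun h : Fin (t + 1) → α =>
      F h * ∫⁻ ω', f (Q (h (Fin.last t)) 1 ω') ∂μ) Measurable.of_discrete hH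
    simp only [Fin.val_last] at this
    rw [← this, lintegral_countable']
    congr 1; ext p
    rw [Measure.map_apply hH (measurableSet_singleton _)]
    rfl
  rw [h1, h2]
  congr 1; ext h
  have h3 : ∫⁻ ω', f (Q (h (Fin.last t)) 1 ω') ∂μ =
      ∑' y, f y * μ {ω | Q (h (Fin.last t)) 1 ω = y} := by
    rw [← lintegral_map (μ := μ) Measurable.of_discrete (hQ.measurable _ 1), lintegral_countable']
    congr 1; ext y
    rw [Measure.map_apply (hQ.measurable _ 1) (measurableSet_singleton _)]
    rfl
  rw [h3, mul_assoc, ← ENNReal.tsum_mul_right, ← ENNReal.tsum_mul_left]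
  congr 1; ext y
  -- The Markov property takes a path on all of ℕ; its values after time t are irrelevant and are
  -- filled with `y`.
  have hm := hQ.markov x t (fun s => if hs : s < t + 1 then h ⟨s, hs⟩ else y) y
  have e1 : ∀ ω, (∀ s ≤ t, Q x s ω = (fun s => if hs : s < t + 1 then h ⟨s, hs⟩ else y) s) ↔
      (fun s : Fin (t + 1) => Q x s ω) = h := by
    intro ω
    rw [funext_iff, Fin.forall_iff]
    refine forall_congr' fun s => ?_
    constructor
    · intro hs hlt
      simpa [hlt] using hs (Nat.lt_succ_iff.mp hlt)
    · intro hs hle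
      have hlt := Nat.lt_succ_iff.mpr hle
      simpa [hlt] using hs hlt
  simp only [e1] at hm
  have e2 : (if hs : t < t + 1 then h ⟨t, hs⟩ else y) = h (Fin.last t) := by
    simp [Fin.last]
  rw [e2] at hm
  rw [hm]
  ring

/-- Induction peeling off the last step: avoidance up to time n is a function of the history, so the
Markov property applies to it. -/
theorem killedOp_iterate_apply (G : Set α) (n : ℕ) (f : α → ℝ≥0∞) (x : α) :
    (killedOp μ Q G)^[n] f x =
      ∫⁻ ω, Set.indicator {ω | AvoidsUpTo (fun t => Q x t ω) G n} (fun ω => f (Q x n ω)) ω ∂μ := by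
  classical
  induction n generalizing f with
  | zero =>
    have : ∀ ω, AvoidsUpTo (fun t => Q x t ω) G 0 := fun ω s h1 h2 => by omega
    simp [this, hQ.init]
  | succ n ih =>
    rw [Function.iterate_succ_apply, ih]
    have key := hQ.lintegral_history_mul x n
      (fun h => if ∀ s : Fin (n + 1), 1 ≤ (s : ℕ) → h s ∉ G then 1 else 0) (Gᶜ.indicator f)
    have e1 : ∀ ω, (∀ s : Fin (n + 1), 1 ≤ (s : ℕ) → Q x s ω ∉ G) ↔
        AvoidsUpTo (fun t => Q x t ω) G n := by
      intro ω
      rw [Fin.forall_iff]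
      exact ⟨fun h s h1 h2 => h s (Nat.lt_succ_iff.mpr h2) h1,
        fun h s h1 h2 => h s h2 (Nat.lt_succ_iff.mp h1)⟩
    simp only [e1] at key
    calc _ = ∫⁻ ω, (if AvoidsUpTo (fun t => Q x t ω) G n then 1 else 0) *
          ∫⁻ ω', Gᶜ.indicator f (Q (Q x n ω) 1 ω') ∂μ ∂μ := by
          congr 1; ext ω
          simp [Set.indicator_apply, killedOp]
      _ = _ := key.symm
      _ = _ := by
          congr 1; ext ω
          have : AvoidsUpTo (fun t => Q x t ω) G (n + 1) ↔
              AvoidsUpTo (fun t => Q x t ω) G n ∧ Q x (n + 1) ω ∉ G := by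
            constructor
            · intro h
              exact ⟨fun s h1 h2 => h s h1 (by omega), h (n + 1) (by omega) le_rfl⟩
            · rintro ⟨h, h'⟩ s h1 h2
              rcases Nat.lt_or_ge s (n + 1) with h3 | h3
              · exact h s h1 (by omega)
              · obtain rfl : s = n + 1 := by omega
                exact h'
          by_cases hA : AvoidsUpTo (fun t => Q x t ω) G n <;> by_cases hB : Q x (n + 1) ω ∈ G <;>
            simp [this, hA, hB]

theorem transitionOp_iterate_apply (n : ℕ) (f : α → ℝ≥0∞) (x : α) :
    (killedOp μ Q ∅)^[n] f x = ∫⁻ ω, f (Q x n ω) ∂μ := by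
  rw [hQ.killedOp_iterate_apply]
  have : ∀ ω, AvoidsUpTo (fun t => Q x t ω) ∅ n := fun ω s _ _ => by simp
  simp [this]

theorem measurableSet_avoidsUpTo (x : α) (G : Set α) (n : ℕ) :
    MeasurableSet {ω | AvoidsUpTo (fun t => Q x t ω) G n} := by
  have : {ω | AvoidsUpTo (fun t => Q x t ω) G n} =
      ⋂ s, ⋂ (_ : 1 ≤ s), ⋂ (_ : s ≤ n), Q x s ⁻¹' Gᶜ := by
    ext ω; simp [AvoidsUpTo]
  rw [this]
  exact MeasurableSet.iInter fun s => MeasurableSet.iInter fun _ => MeasurableSet.iInter fun _ =>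
    hQ.measurable x s (MeasurableSet.of_discrete)

theorem killedOp_iterate_one (G : Set α) (n : ℕ) (x : α) :
    (killedOp μ Q G)^[n] (fun _ => 1) x = μ {ω | AvoidsUpTo (fun t => Q x t ω) G n} := by
  rw [hQ.killedOp_iterate_apply, lintegral_indicator (hQ.measurableSet_avoidsUpTo x G n)]
  simp

theorem meanReturnTime_eq_tsum (x : α) (G : Set α) :
    meanReturnTime μ Q x G = ∑' n, (killedOp μ Q G)^[n] (fun _ => 1) x := by
  simp only [meanReturnTime, returnTime_eq_tsum]
  rw [lintegral_tsum]
  · congr 1; ext n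
    rw [hQ.killedOp_iterate_one, ← lintegral_indicator_one (hQ.measurableSet_avoidsUpTo x G n)]
    rfl
  · intro n
    exact (measurable_one.indicator (hQ.measurableSet_avoidsUpTo x G n)).aemeasurable

/-- First step analysis. -/
theorem meanReturnTime_eq_one_add (x : α) (G : Set α) :
    meanReturnTime μ Q x G = 1 + killedOp μ Q G (fun y => meanReturnTime μ Q y G) x := by
  simp only [hQ.meanReturnTime_eq_tsum]
  rw [killedOp_tsum hQ.measurable, tsum_eq_zero_add' ENNReal.summable]
  simp only [killedOp_iterate_succ]
  simp

/-- A supersolution of the first step equation bounds the mean return time. -/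
theorem meanReturnTime_le_of_drift {G : Set α} {W : α → ℝ≥0∞}
    (hW : ∀ y, killedOp μ Q G W y + 1 ≤ W y) (x : α) : meanReturnTime μ Q x G ≤ W x := by
  rw [hQ.meanReturnTime_eq_tsum]
  refine ENNReal.tsum_le_of_sum_range_le fun n => ?_
  induction n generalizing x with
  | zero => simp
  | succ n ih =>
    -- The partial sums satisfy S (n+1) = K (S n) + 1 for the killed operator K, so monotonicity of
    -- K carries the bound S n ≤ W to n+1.
    rw [Finset.sum_range_succ']
    simp only [killedOp_iterate_succ, Function.iterate_zero, id_eq]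
    rw [← killedOp_sum hQ.measurable]
    exact (add_le_add_left (killedOp_mono (fun y _ => ih y) x) 1).trans (hW x)

theorem isAccessible_refl (x : α) : IsAccessible μ Q x x :=
  ⟨0, by simp [hQ.init]⟩

theorem transitionOp_iterate_mono {f g : α → ℝ≥0∞} (h : ∀ x, f x ≤ g x) (n : ℕ) (x : α) :
    (killedOp μ Q ∅)^[n] f x ≤ (killedOp μ Q ∅)^[n] g x := by
  rw [hQ.transitionOp_iterate_apply, hQ.transitionOp_iterate_apply]
  exact lintegral_mono fun ω => h _

/-- The Chapman–Kolmogorov inequality: restrict to the paths that are at `y` at time m. -/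
theorem measure_pos_trans {x y z : α} {m n : ℕ} (hm : 0 < μ {ω | Q x m ω = y})
    (hn : 0 < μ {ω | Q y n ω = z}) : 0 < μ {ω | Q x (m + n) ω = z} := by
  have hit : ∀ x y t, μ {ω | Q x t ω = y} = (killedOp μ Q ∅)^[t] (Set.indicator {y} 1) x := by
    intro x y t
    rw [hQ.transitionOp_iterate_apply]
    have hm : MeasurableSet {ω | Q x t ω = y} := hQ.measurable x t (measurableSet_singleton y)
    rw [← lintegral_indicator_one hm]
    rfl
  rw [hit] at *
  rw [Function.iterate_add_apply]
  set f := (killedOp μ Q ∅)^[n] (Set.indicator {z} 1) with hf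
  have h1 : ∀ w, f y * Set.indicator {y} 1 w ≤ f w := by
    intro w
    by_cases hw : w = y
    · subst hw; simp
    · simp [hw]
  refine lt_of_lt_of_le ?_ (hQ.transitionOp_iterate_mono h1 m x)
  have h2 : (killedOp μ Q ∅)^[m] (fun w => f y * Set.indicator {y} 1 w) x =
      f y * (killedOp μ Q ∅)^[m] (Set.indicator {y} 1) x := by
    rw [hQ.transitionOp_iterate_apply, hQ.transitionOp_iterate_apply, lintegral_const_mul _
      (measurable_discrete_comp (hQ.measurable x m) _)]
  rw [h2]
  exact ENNReal.mul_pos hn.ne' hm.ne'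

theorem isAccessible_trans {x y z : α} (hxy : IsAccessible μ Q x y) (hyz : IsAccessible μ Q y z) :
    IsAccessible μ Q x z := by
  obtain ⟨m, hm⟩ := hxy
  obtain ⟨n, hn⟩ := hyz
  exact ⟨m + n, hQ.measure_pos_trans hm hn⟩

/-- If the mean return time of `A` is finite then some state of `A` is accessible, at a positive
time. -/
theorem exists_pos_measure_of_meanReturnTime_lt_top {x : α} {A : Set α}
    (h : meanReturnTime μ Q x A < ∞) :
    ∃ y ∈ A, ∃ t, 1 ≤ t ∧ 0 < μ {ω | Q x t ω = y} := by
  by_contra! hcon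
  have hne : ∀ᵐ ω ∂μ, ∀ t, 1 ≤ t → Q x t ω ∉ A := by
    rw [ae_all_iff]
    intro t
    by_cases ht : 1 ≤ t
    · have : ∀ᵐ ω ∂μ, ∀ y, y ∈ A → Q x t ω ≠ y := by
        rw [ae_all_iff]
        intro y
        by_cases hy : y ∈ A
        · have := hcon y hy t ht
          rw [ae_iff]
          simpa [hy] using this
        · exact Filter.Eventually.of_forall fun ω h => absurd h hy
      filter_upwards [this] with ω hω _ hA
      exact hω _ hA rfl
    · exact Filter.Eventually.of_forall fun ω h => absurd h ht
  have : meanReturnTime μ Q x A = ∫⁻ _, ∞ ∂μ := by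
    refine lintegral_congr_ae ?_
    filter_upwards [hne] with ω hω
    simp only [returnTime, iInf_eq_top]
    exact fun t ht => absurd ht.2 (hω t ht.1)
  simp [this] at h

theorem killedOp_iterate_one_le_one (G : Set α) (n : ℕ) (x : α) :
    (killedOp μ Q G)^[n] (fun _ => 1) x ≤ 1 := by
  rw [hQ.killedOp_iterate_one]
  exact prob_le_one

/-- If the finite set `A` is visited again and again, with finite mean times between the visits,
and `G` can be reached from `A`, then `G` is reached in finite mean time. -/
theorem meanReturnTime_lt_top_of_finite {A G : Set α} (hA : A.Finite)
    (hret : ∀ y ∈ A, meanReturnTime μ Q y A < ∞)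
    (hacc : ∀ y ∈ A, ∃ t, 1 ≤ t ∧ 0 < μ {ω | Q y t ω ∈ G}) {x : α}
    (hx : meanReturnTime μ Q x A < ∞) : meanReturnTime μ Q x G < ∞ := by
  classical
  choose! τ hτ1 hτ using hacc
  -- Within m steps `G` is entered with positive probability from each state of the finite set `A`.
  set m := hA.toFinset.sup τ with hm
  have hlt : ∀ y ∈ A, (killedOp μ Q G)^[m] (fun _ => 1) y < 1 := by
    intro y hy
    rw [hQ.killedOp_iterate_one]
    have hmeas : MeasurableSet {ω | Q y (τ y) ω ∈ G} := hQ.measurable y _ (MeasurableSet.of_discrete)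
    calc μ {ω | AvoidsUpTo (fun t => Q y t ω) G m} ≤ μ {ω | Q y (τ y) ω ∈ G}ᶜ := by
          refine measure_mono fun ω hω hG => ?_
          exact hω (τ y) (hτ1 y hy) (Finset.le_sup (f := τ) (by simpa using hy)) hG
      _ < 1 := by
          rw [prob_compl_eq_one_sub hmeas]
          exact ENNReal.sub_lt_self ENNReal.one_ne_top one_ne_zero (hτ y hy).ne'
  -- A success probability common to all states of `A`. The minimum with 1 keeps it finite when `A`
  -- is empty.
  set p : ℝ≥0∞ := min 1 (hA.toFinset.inf fun y => 1 - (killedOp μ Q G)^[m] (fun _ => 1) y) with hp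
  have hp0 : 0 < p := by
    rw [hp, lt_min_iff, Finset.lt_inf_iff ENNReal.zero_lt_top]
    refine ⟨one_pos, fun y hy => ?_⟩
    rw [tsub_pos_iff_lt]
    exact hlt y (by simpa using hy)
  have hptop : p ≠ ∞ := ne_top_of_le_ne_top ENNReal.one_ne_top (min_le_left _ _)
  have hpA : ∀ y ∈ A, (killedOp μ Q G)^[m] (fun _ => 1) y + p ≤ 1 := by
    intro y hy
    have : p ≤ 1 - (killedOp μ Q G)^[m] (fun _ => 1) y :=
      (min_le_right _ _).trans (Finset.inf_le (by simpa using hy))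
    calc _ ≤ (killedOp μ Q G)^[m] (fun _ => 1) y + (1 - (killedOp μ Q G)^[m] (fun _ => 1) y) := by
          gcongr
      _ = 1 := add_tsub_cancel_of_le (hlt y hy).le
  -- The mean of the return time to `G` truncated at m. Its one-step change telescopes to K^m 1 - 1:
  -- never positive, and at most -p on `A`.
  set S : α → ℝ≥0∞ := fun y => ∑ i ∈ Finset.range m, (killedOp μ Q G)^[i] (fun _ => 1) y with hS
  have hKS : ∀ y, killedOp μ Q G S y + 1 = S y + (killedOp μ Q G)^[m] (fun _ => 1) y := by
    intro y
    rw [hS, killedOp_sum hQ.measurable, ← Finset.sum_range_succ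
      (fun i => (killedOp μ Q G)^[i] (fun _ => 1) y), Finset.sum_range_succ']
    simp only [killedOp_iterate_succ]
    rfl
  have hSle : ∀ y, killedOp μ Q G S y ≤ S y := by
    intro y
    have h := hKS y
    have h1 : S y + (killedOp μ Q G)^[m] (fun _ => 1) y ≤ S y + 1 := by
      gcongr
      exact hQ.killedOp_iterate_one_le_one G m y
    rw [← h] at h1
    exact (ENNReal.add_le_add_iff_right ENNReal.one_ne_top).mp h1
  have hSA : ∀ y ∈ A, killedOp μ Q G S y + p ≤ S y := by
    intro y hy
    refine (ENNReal.add_le_add_iff_right ENNReal.one_ne_top).mp ?_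
    calc killedOp μ Q G S y + p + 1 = killedOp μ Q G S y + 1 + p := by ring
      _ = S y + ((killedOp μ Q G)^[m] (fun _ => 1) y + p) := by rw [hKS]; ring
      _ ≤ S y + 1 := by gcongr; exact hpA y hy
  set f : α → ℝ≥0∞ := Aᶜ.indicator fun y => meanReturnTime μ Q y A with hf
  set β : ℝ≥0∞ := ∑ y ∈ hA.toFinset, meanReturnTime μ Q y A with hβ
  have hβtop : β ≠ ∞ := by
    rw [hβ, ENNReal.sum_ne_top]
    exact fun y hy => (hret y (by simpa using hy)).ne
  have hKf : ∀ y, killedOp μ Q G f y + 1 ≤ meanReturnTime μ Q y A := by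
    intro y
    rw [hQ.meanReturnTime_eq_one_add y A, add_comm]
    gcongr
    refine (killedOp_le_killedOp_empty f y).trans (le_of_eq ?_)
    rw [killedOp_empty]
    rfl
  have hcp : β / p * p = β := ENNReal.div_mul_cancel hp0.ne' hptop
  have hctop : β / p ≠ ∞ := ENNReal.div_ne_top hβtop hp0.ne'
  -- Off `A` the term f, the mean time to reach `A`, supplies the drift. On `A`, where f vanishes,
  -- its expected value after one step plus 1 is at most β, and this is paid for by the decrease p
  -- of S multiplied by β / p.
  have hW : ∀ y, killedOp μ Q G (fun z => f z + β / p * S z) y + 1 ≤ f y + β / p * S y := by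
    intro y
    rw [killedOp_add hQ.measurable, killedOp_const_mul hQ.measurable]
    by_cases hy : y ∈ A
    · have h1 : meanReturnTime μ Q y A ≤ β :=
        Finset.single_le_sum (f := fun y => meanReturnTime μ Q y A) (fun _ _ => zero_le)
          (by simpa using hy)
      calc _ = (killedOp μ Q G f y + 1) + β / p * killedOp μ Q G S y := by ring
        _ ≤ β + β / p * killedOp μ Q G S y := by gcongr; exact (hKf y).trans h1
        _ = β / p * (killedOp μ Q G S y + p) := by rw [mul_add, hcp, add_comm]
        _ ≤ β / p * S y := by gcongr; exact hSA y hy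
        _ ≤ f y + β / p * S y := le_add_self
    · have h1 : f y = meanReturnTime μ Q y A := by simp [hf, hy]
      calc _ = (killedOp μ Q G f y + 1) + β / p * killedOp μ Q G S y := by ring
        _ ≤ f y + β / p * S y := by
          rw [h1]
          gcongr
          · exact hKf y
          · exact hSle y
  refine (hQ.meanReturnTime_le_of_drift hW x).trans_lt ?_
  refine ENNReal.add_lt_top.mpr ⟨?_, ENNReal.mul_lt_top hctop.lt_top ?_⟩
  · exact (Set.indicator_le_self Aᶜ (fun y => meanReturnTime μ Q y A) x).trans_lt hx
  · refine ENNReal.sum_lt_top.mpr fun i _ => ?_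
    exact (hQ.killedOp_iterate_one_le_one G i x).trans_lt ENNReal.one_lt_top

/-- Foster's criterion with a drift over `T` steps. -/
theorem meanReturnTime_lt_top_of_multistep_drift {V : α → ℝ≥0∞} {T : ℕ} {B : Set α}
    (hfin : ∀ n x, ∫⁻ ω, V (Q x n ω) ∂μ < ∞)
    (hdrift : ∀ x, x ∉ B → ∫⁻ ω, V (Q x T ω) ∂μ + 1 ≤ V x) (x : α) :
    meanReturnTime μ Q x B < ∞ := by
  classical
  have hV : ∀ x, V x ≠ ∞ := fun x => by simpa [hQ.init] using (hfin 0 x).ne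
  -- Summing over T consecutive times turns a T-step drift into a one-step drift: the one-step
  -- change of W is the T-step change of V.
  set W : α → ℝ≥0∞ := fun y => ∑ i ∈ Finset.range T, (killedOp μ Q ∅)^[i] V y with hW
  have hKW : ∀ y, killedOp μ Q ∅ W y + V y = W y + (killedOp μ Q ∅)^[T] V y := by
    intro y
    rw [hW, killedOp_sum hQ.measurable, ← Finset.sum_range_succ
      (fun i => (killedOp μ Q ∅)^[i] V y), Finset.sum_range_succ']
    simp only [killedOp_iterate_succ]
    rfl
  have hWB : ∀ y, y ∉ B → killedOp μ Q ∅ W y + 1 ≤ W y := by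
    intro y hy
    refine (ENNReal.add_le_add_iff_right (hV y)).mp ?_
    calc killedOp μ Q ∅ W y + 1 + V y = (killedOp μ Q ∅ W y + V y) + 1 := by ring
      _ = W y + ((killedOp μ Q ∅)^[T] V y + 1) := by rw [hKW]; ring
      _ ≤ W y + V y := by
        gcongr
        rw [hQ.transitionOp_iterate_apply]
        exact hdrift y hy
  have hWtop : ∀ y, W y < ∞ := by
    intro y
    refine ENNReal.sum_lt_top.mpr fun i _ => ?_
    rw [hQ.transitionOp_iterate_apply]
    exact hfin i y
  have hKWtop : ∀ y, killedOp μ Q ∅ W y < ∞ := by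
    intro y
    refine lt_of_le_of_lt le_self_add ((hKW y).trans_lt ?_)
    refine ENNReal.add_lt_top.mpr ⟨hWtop y, ?_⟩
    rw [hQ.transitionOp_iterate_apply]
    exact hfin T y
  -- The operator killed on `B` ignores values on `B`, so there the function may be redefined to
  -- make the inequality trivial.
  have hdr : ∀ y, killedOp μ Q B (fun z => if z ∈ B then killedOp μ Q ∅ W z + 1 else W z) y + 1 ≤
      if y ∈ B then killedOp μ Q ∅ W y + 1 else W y := by
    intro y
    have h1 : killedOp μ Q B (fun z => if z ∈ B then killedOp μ Q ∅ W z + 1 else W z) y ≤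
        killedOp μ Q ∅ W y :=
      (killedOp_mono (fun z hz => by simp [hz]) y).trans (killedOp_le_killedOp_empty W y)
    split_ifs with hy
    · gcongr
    · exact (add_le_add_left h1 1).trans (hWB y hy)
  refine (hQ.meanReturnTime_le_of_drift hdr x).trans_lt ?_
  split_ifs
  · exact ENNReal.add_lt_top.mpr ⟨hKWtop x, ENNReal.one_lt_top⟩
  · exact hWtop x

theorem ae_isAccessible (x : α) : ∀ᵐ ω ∂μ, ∀ t, IsAccessible μ Q x (Q x t ω) := by
  rw [ae_all_iff]
  intro t
  have : ∀ᵐ ω ∂μ, ∀ y, ¬ IsAccessible μ Q x y → Q x t ω ≠ y := by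
    rw [ae_all_iff]
    intro y
    by_cases hy : IsAccessible μ Q x y
    · exact Filter.Eventually.of_forall fun ω h => absurd hy h
    · have : μ {ω | Q x t ω = y} = 0 := by
        by_contra h
        exact hy ⟨t, pos_iff_ne_zero.mpr h⟩
      rw [ae_iff]
      simpa [hy] using this
  filter_upwards [this] with ω hω
  by_contra h
  exact hω _ h rfl

/-- A chain that reaches a finite set in finite mean time from every state is positive
recurrent. -/
theorem isPositiveRecurrent_of_finite {B : Set α} (hB : B.Finite)
    (hret : ∀ x, meanReturnTime μ Q x B < ∞) : IsPositiveRecurrent μ Q where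
  essential := by
    intro x hx
    -- Started at a state accessible from x, the chain almost surely stays among such states, so
    -- restricting `B` to them does not alter the return time.
    have hsub : ∀ y, IsAccessible μ Q x y →
        meanReturnTime μ Q y (B ∩ {z | IsAccessible μ Q x z}) < ∞ := by
      intro y hy
      refine lt_of_eq_of_lt (lintegral_congr_ae ?_) (hret y)
      filter_upwards [hQ.ae_isAccessible y] with ω hω
      simp only [returnTime]
      refine iInf_congr fun t => ?_
      have : Q y t ω ∈ B ∩ {z | IsAccessible μ Q x z} ↔ Q y t ω ∈ B :=
        ⟨fun h => h.1, fun h => ⟨h, hQ.isAccessible_trans hy (hω t)⟩⟩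
      rw [this]
    refine hQ.meanReturnTime_lt_top_of_finite (hB.inter_of_left _)
      (fun y hy => hsub y hy.2) (fun y hy => ?_) (hsub x (hQ.isAccessible_refl x))
    obtain ⟨z, hz, t, ht, hpos⟩ := hQ.exists_pos_measure_of_meanReturnTime_lt_top (hsub y hy.2)
    obtain ⟨t', ht'⟩ := hx z hz.2
    refine ⟨t + t', by omega, (hQ.measure_pos_trans hpos ht').trans_le (measure_mono fun ω hω => ?_)⟩
    rw [Set.mem_ofPred_eq] at hω ⊢
    rw [hω]
    rfl
  absorbed := by
    classical
    have hess : ∀ x, ∃ y ∈ B, IsAccessible μ Q x y ∧ IsEssential μ Q y := by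
      intro x
      set S : Set α := {y | y ∈ B ∧ IsAccessible μ Q x y} with hS
      have hSne : S.Nonempty := by
        obtain ⟨y, hy, t, _, ht⟩ := hQ.exists_pos_measure_of_meanReturnTime_lt_top (hret x)
        exact ⟨y, hy, t, ht⟩
      have hSfin : S.Finite := hB.subset fun y hy => hy.1
      -- Choose y with the fewest accessible states in `B`. Whatever is reached from y leads to some
      -- w in `B`, which by minimality has the same accessible states in `B`, including y; hence y
      -- is essential.
      obtain ⟨y, hy, hmin⟩ := Set.exists_min_image S
        (fun y => (B ∩ {z | IsAccessible μ Q y z}).ncard) hSfin hSne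
      refine ⟨y, hy.1, hy.2, fun z hyz => ?_⟩
      obtain ⟨w, hw, t, _, ht⟩ := hQ.exists_pos_measure_of_meanReturnTime_lt_top (hret z)
      have hzw : IsAccessible μ Q z w := ⟨t, ht⟩
      have hyw := hQ.isAccessible_trans hyz hzw
      have hle := hmin w ⟨hw, hQ.isAccessible_trans hy.2 hyw⟩
      have heq : B ∩ {v | IsAccessible μ Q w v} = B ∩ {v | IsAccessible μ Q y v} :=
        Set.eq_of_subset_of_ncard_le
          (fun v hv => ⟨hv.1, hQ.isAccessible_trans hyw hv.2⟩) hle (hB.inter_of_left _)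
      have hmem : y ∈ B ∩ {v | IsAccessible μ Q w v} := by
        rw [heq]
        exact ⟨hy.1, hQ.isAccessible_refl y⟩
      exact hQ.isAccessible_trans hzw hmem.2
    refine ⟨B ∩ {y | IsEssential μ Q y}, hB.inter_of_left _, fun y hy => hy.2, fun x => ?_⟩
    refine hQ.meanReturnTime_lt_top_of_finite hB (fun y _ => hret y) (fun y hy => ?_) (hret x)
    obtain ⟨w, hw, t, ht, hpos⟩ := hQ.exists_pos_measure_of_meanReturnTime_lt_top (hret y)
    obtain ⟨z, hz, ⟨t', ht'⟩, hze⟩ := hess w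
    refine ⟨t + t', by omega, (hQ.measure_pos_trans hpos ht').trans_le (measure_mono fun ω hω => ?_)⟩
    rw [Set.mem_ofPred_eq] at hω ⊢
    rw [hω]
    exact ⟨hz, hze⟩

end IsMarkovChain

end MarkovChain

/-! ### The network as a deterministic recursion driven by its primitives -/

theorem card_filter_range_add (p : ℕ → Prop) [DecidablePred p] (m n : ℕ) :
    ((Finset.range (m + n)).filter p).card =
      ((Finset.range m).filter p).card + ((Finset.range n).filter fun k => p (m + k)).card := by
  simp only [Finset.card_filter]
  rw [Finset.sum_range_add]

namespace SwitchedNetwork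

variable {J : Type*} [Fintype J] [DecidableEq J]

/-- A common value space for the random elements that drive the network. -/
abbrev PrimitiveValue (J : Type*) := ℕ × Bool × Option J × ((J → ℕ) → (J → ℕ))

instance : MeasurableSpace (Option J) := ⊤

instance : DiscreteMeasurableSpace (Option J) := ⟨fun _ => trivial⟩

/-- Realizations of all the random elements that drive the network. -/
abbrev Realization (J : Type*) := PrimitiveIndex J → PrimitiveValue J

/-- Queue lengths, cumulative work, and cumulative departures. -/
abbrev NetworkState (J : Type*) := (J → ℕ) × (J → ℕ) × (J → ℕ)

namespace Realization

/-- The work done at time `t`. -/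
def work (z : Realization J) (t : ℕ) (q : J → ℕ) (j : J) : ℕ :=
  min ((z (.rule t)).2.2.2 q j) (q j)

/-- The number of jobs completed at `j` by `w` units of work, after `k` previous units. -/
def completed (z : Realization J) (k w : ℕ) (j : J) : ℕ :=
  ((Finset.range w).filter fun u => (z (.service j (k + u))).2.1 = true).card

/-- The number of jobs routed from `i` to `j` among `m` departures, after `d` previous ones. -/
def routed (z : Realization J) (d m : ℕ) (i j : J) : ℕ :=
  ((Finset.range m).filter fun u => (z (.routing i (d + u))).2.2.1 = some j).card

/-- The number of departures from `j` at time `t`. -/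
def departed (z : Realization J) (t : ℕ) (s : NetworkState J) (j : J) : ℕ :=
  z.completed (s.2.1 j) (z.work t s.1 j) j

/-- The evolution of the network in one unit of time. -/
def step (z : Realization J) (t : ℕ) (s : NetworkState J) : NetworkState J :=
  (fun j => s.1 j + (z (.arrival j t)).1 + ∑ i, z.routed (s.2.2 i) (z.departed t s i) i j -
      z.departed t s j,
    fun j => s.2.1 j + z.work t s.1 j, fun j => s.2.2 j + z.departed t s j)

/-- The evolution of the network started at `x`. -/
def run (z : Realization J) (x : J → ℕ) : ℕ → NetworkState J
  | 0 => (x, 0, 0)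
  | t + 1 => z.step t (z.run x t)

/-- The indices of the random elements used up to time `t` when the cumulative work is `k` and the
cumulative departures are `d`. -/
def usedIndices (t : ℕ) (k d : J → ℕ) : Set (PrimitiveIndex J)
  | .arrival _ s => s < t
  | .service j u => u < k j
  | .routing j n => n < d j
  | .rule s => s < t

/-- The enumeration of the random elements that are not in `usedIndices`. -/
def shiftIndex (t : ℕ) (k d : J → ℕ) : PrimitiveIndex J → PrimitiveIndex J
  | .arrival j s => .arrival j (t + s)
  | .service j u => .service j (k j + u)
  | .routing j n => .routing j (d j + n)
  | .rule s => .rule (t + s)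

theorem shiftIndex_injective (t : ℕ) (k d : J → ℕ) : Function.Injective (shiftIndex t k d) := by
  rintro (⟨j, s⟩ | ⟨j, s⟩ | ⟨j, s⟩ | s) (⟨j', s'⟩ | ⟨j', s'⟩ | ⟨j', s'⟩ | s') h <;>
    simp only [shiftIndex, reduceCtorEq, PrimitiveIndex.arrival.injEq, PrimitiveIndex.service.injEq,
      PrimitiveIndex.routing.injEq, PrimitiveIndex.rule.injEq] at h ⊢
  · obtain ⟨rfl, h⟩ := h; exact ⟨rfl, by omega⟩
  · obtain ⟨rfl, h⟩ := h; exact ⟨rfl, by omega⟩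
  · obtain ⟨rfl, h⟩ := h; exact ⟨rfl, by omega⟩
  · omega

theorem disjoint_usedIndices (t : ℕ) (k d : J → ℕ) :
    Disjoint (usedIndices t k d) (Set.range (shiftIndex t k d)) := by
  rw [Set.disjoint_left]
  rintro _ h ⟨i, rfl⟩
  rcases i with ⟨j, s⟩ | ⟨j, s⟩ | ⟨j, s⟩ | s
  · exact Nat.not_lt.mpr (Nat.le_add_right t s) h
  · exact Nat.not_lt.mpr (Nat.le_add_right (k j) s) h
  · exact Nat.not_lt.mpr (Nat.le_add_right (d j) s) h
  · exact Nat.not_lt.mpr (Nat.le_add_right t s) h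

theorem completed_le (z : Realization J) (k w : ℕ) (j : J) : z.completed k w j ≤ w :=
  (Finset.card_filter_le _ _).trans (by simp)

theorem departed_le (z : Realization J) (t : ℕ) (s : NetworkState J) (j : J) :
    z.departed t s j ≤ s.1 j :=
  (z.completed_le _ _ _).trans (min_le_right _ _)

/-- The Markov property of a realization. -/
theorem step_fst_eq_run_shift (z : Realization J) (t : ℕ) (q k d : J → ℕ) :
    (z.step t (q, k, d)).1 = (run (fun i => z (shiftIndex t k d i)) q 1).1 := by
  simp [run, step, departed, work, completed, routed, shiftIndex]

theorem usedIndices_mono {t t' : ℕ} {k k' d d' : J → ℕ} (ht : t ≤ t') (hk : k ≤ k') (hd : d ≤ d') :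
    usedIndices t k d ⊆ usedIndices t' k' d' := by
  rintro (⟨j, s⟩ | ⟨j, s⟩ | ⟨j, s⟩ | s) h
  · exact lt_of_lt_of_le (show s < t from h) ht
  · exact lt_of_lt_of_le (show s < k j from h) (hk j)
  · exact lt_of_lt_of_le (show s < d j from h) (hd j)
  · exact lt_of_lt_of_le (show s < t from h) ht

/-- The indices of the random elements used in the first `t` units of time. -/
def usedBy (z : Realization J) (x : J → ℕ) (t : ℕ) : Set (PrimitiveIndex J) :=
  usedIndices t (z.run x t).2.1 (z.run x t).2.2

theorem usedBy_mono (z : Realization J) (x : J → ℕ) : Monotone (z.usedBy x) :=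
  monotone_nat_of_le_succ fun t => usedIndices_mono (Nat.le_succ t)
    (fun _ => Nat.le_add_right _ _) (fun _ => Nat.le_add_right _ _)

/-- The analogue of a stopping time: the set of consulted primitives is read off from `z` itself,
and agreement on that set alone already forces the two evolutions to coincide. By induction, as each
step consults only rules and arrivals of the current time and the next service and routing
variables. -/
theorem run_congr {z z' : Realization J} (x : J → ℕ) (t : ℕ)
    (h : ∀ i ∈ z.usedBy x t, z i = z' i) : z.run x t = z'.run x t := by
  induction t with
  | zero => rfl
  | succ t ih =>
    have ih' := ih fun i hi => h i (z.usedBy_mono x (Nat.le_succ t) hi)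
    have hw : ∀ j, z.work t (z.run x t).1 j = z'.work t (z.run x t).1 j := by
      intro j
      have : z (.rule t) = z' (.rule t) := h _ (Nat.lt_succ_self t)
      simp only [work, this]
    have hd : ∀ j, z.departed t (z.run x t) j = z'.departed t (z.run x t) j := by
      intro j
      simp only [departed, ← hw, completed]
      congr 1
      refine Finset.filter_congr fun u hu => ?_
      rw [h (.service j ((z.run x t).2.1 j + u))]
      exact Nat.add_lt_add_left (Finset.mem_range.mp hu) _
    have hr : ∀ i j, z.routed ((z.run x t).2.2 i) (z.departed t (z.run x t) i) i j =
        z'.routed ((z.run x t).2.2 i) (z.departed t (z.run x t) i) i j := by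
      intro i j
      simp only [routed]
      congr 1
      refine Finset.filter_congr fun u hu => ?_
      rw [h (.routing i ((z.run x t).2.2 i + u))]
      exact Nat.add_lt_add_left (Finset.mem_range.mp hu) _
    have ha : ∀ j, z (.arrival j t) = z' (.arrival j t) := fun j => h _ (Nat.lt_succ_self t)
    change z.step t (z.run x t) = z'.step t (z'.run x t)
    rw [← ih']
    simp only [step, hr, ha]
    simp only [hd, hw]

section Measurability

theorem measurable_apply_coord {β : Type*} [MeasurableSpace β] {z : β → Realization J}
    (hz : ∀ i, Measurable fun b => z b i) {q : β → J → ℕ} (hq : Measurable q) (t : ℕ) :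
    Measurable fun b => (z b (.rule t)).2.2.2 (q b) := by
  have h1 : Measurable fun p : ((J → ℕ) → (J → ℕ)) × (J → ℕ) => p.1 p.2 :=
    measurable_from_prod_countable_left fun y => measurable_pi_apply y
  exact h1.comp ((hz (.rule t)).snd.snd.snd.prodMk hq)

/-- A countably valued family of functions evaluated at a random index. -/
theorem measurable_eval_countable {β γ ι : Type*} [MeasurableSpace β] [MeasurableSpace γ]
    [MeasurableSpace ι] [DiscreteMeasurableSpace ι] [Countable ι] {f : ι → β → γ}
    (hf : ∀ i, Measurable (f i)) {g : β → ι} (hg : Measurable g) :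
    Measurable fun b => f (g b) b := by
  have h1 : Measurable fun p : β × ι => f p.2 p.1 :=
    measurable_from_prod_countable_left fun y => hf y
  exact h1.comp (measurable_id.prodMk hg)

theorem measurable_card_filter {β : Type*} [MeasurableSpace β] {s : ℕ} {p : ℕ → β → Prop}
    [∀ u b, Decidable (p u b)] (hp : ∀ u, MeasurableSet {b | p u b}) :
    Measurable fun b => ((Finset.range s).filter fun u => p u b).card := by
  simp only [Finset.card_filter]
  exact Finset.measurable_sum _ fun u _ =>
    Measurable.ite (hp u) measurable_const measurable_const

theorem measurable_step {β : Type*} [MeasurableSpace β] {z : β → Realization J}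
    (hz : ∀ i, Measurable fun b => z b i) (t : ℕ) (s : NetworkState J) :
    Measurable fun b => (z b).step t s := by
  have hwork : ∀ j, Measurable fun b => (z b).work t s.1 j := by
    intro j
    have := measurable_pi_iff.mp (measurable_apply_coord hz (measurable_const (a := s.1)) t) j
    exact this.min measurable_const
  have hcomp : ∀ k w j, Measurable fun b => (z b).completed k w j := fun k w j =>
    measurable_card_filter fun u => (hz _).snd.fst (measurableSet_singleton true)
  have hrout : ∀ d m i j, Measurable fun b => (z b).routed d m i j := fun d m i j =>
    measurable_card_filter fun u => (hz _).snd.snd.fst (measurableSet_singleton (some j))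
  have hdep : ∀ j, Measurable fun b => (z b).departed t s j := fun j =>
    measurable_eval_countable (fun w => hcomp (s.2.1 j) w j) (hwork j)
  have hrd : ∀ i j, Measurable fun b => (z b).routed (s.2.2 i) ((z b).departed t s i) i j :=
    fun i j => measurable_eval_countable (fun m => hrout (s.2.2 i) m i j) (hdep i)
  refine Measurable.prodMk (measurable_pi_lambda _ fun j => ?_)
    (Measurable.prodMk (measurable_pi_lambda _ fun j => ?_) (measurable_pi_lambda _ fun j => ?_))
  · exact ((measurable_const.add (hz _).fst).add
      (Finset.measurable_sum _ fun i _ => hrd i j)).sub (hdep j)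
  · exact measurable_const.add (hwork j)
  · exact measurable_const.add (hdep j)

theorem measurable_run {β : Type*} [MeasurableSpace β] {z : β → Realization J}
    (hz : ∀ i, Measurable fun b => z b i) (x : J → ℕ) (t : ℕ) :
    Measurable fun b => (z b).run x t := by
  induction t with
  | zero => exact measurable_const
  | succ t ih => exact measurable_eval_countable (fun s => measurable_step hz t s) ih

end Measurability

end Realization

namespace Primitives

variable {Ω : Type*} (X : Primitives J Ω)

/-- The realization of all the random elements. -/
def realization (ω : Ω) : Realization J
  | .arrival j t => (X.arrival j t ω, false, none, 0)
  | .service j u => (0, X.service j u ω, none, 0)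
  | .routing j d => (0, false, X.routing j d ω, 0)
  | .rule t => (0, false, none, X.rule t ω)

/-- Subtracting the balance equations at times t and t+1 leaves a recursion, so the solution is
unique and is a function of the primitives. -/
theorem run_eq_of_isQueueingNetworkSolution {x : J → ℕ} {Q : ℕ → Ω → J → ℕ}
    (hQ : X.IsQueueingNetworkSolution x Q) (ω : Ω) (t : ℕ) :
    (X.realization ω).run x t = (Q t ω, (fun j => X.cumWork ω (fun s => Q s ω) j t),
      fun j => X.departures ω (fun s => Q s ω) j t) := by
  induction t with
  | zero =>
    refine Prod.ext (hQ.init ω).symm (Prod.ext ?_ ?_)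
    · ext j; simp [Realization.run, cumWork]
    · ext j; simp [Realization.run, departures, cumWork, cumServed]
  | succ t ih =>
    have hrun : (X.realization ω).run x (t + 1) =
      (X.realization ω).step t ((X.realization ω).run x t) := rfl
    rw [hrun, ih]
    have hk : ∀ j, X.cumWork ω (fun s => Q s ω) j (t + 1) =
        X.cumWork ω (fun s => Q s ω) j t + (X.realization ω).work t (Q t ω) j := by
      intro j
      simp only [cumWork, Finset.sum_range_succ]
      rfl
    have hd : ∀ j, X.departures ω (fun s => Q s ω) j (t + 1) =
        X.departures ω (fun s => Q s ω) j t +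
        (X.realization ω).departed t (Q t ω, (fun j => X.cumWork ω (fun s => Q s ω) j t),
          fun j => X.departures ω (fun s => Q s ω) j t) j := by
      intro j
      rw [departures, hk, cumServed, card_filter_range_add]
      rfl
    have hr : ∀ i j, X.cumRouted ω i j (X.departures ω (fun s => Q s ω) i (t + 1)) =
        X.cumRouted ω i j (X.departures ω (fun s => Q s ω) i t) +
        (X.realization ω).routed (X.departures ω (fun s => Q s ω) i t)
          ((X.realization ω).departed t (Q t ω, (fun j => X.cumWork ω (fun s => Q s ω) j t),
          fun j => X.departures ω (fun s => Q s ω) j t) i) i j := by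
      intro i j
      rw [hd, cumRouted, card_filter_range_add]
      rfl
    refine Prod.ext ?_ (Prod.ext ?_ ?_)
    · ext j
      have h0 := hQ.balance t ω j
      have h1 := hQ.balance (t + 1) ω j
      simp only [totalArrivals, hr, Finset.sum_add_distrib] at h0 h1
      rw [hd] at h1
      have ha : X.cumArrival ω j (t + 1) =
          X.cumArrival ω j t + (X.realization ω (.arrival j t)).1 := by
        simp only [cumArrival, Finset.sum_range_succ]
        rfl
      rw [ha] at h1
      -- Departures do not exceed the queue, so the truncated subtraction in `step` is a true
      -- subtraction.
      have hle := (X.realization ω).departed_le t (Q t ω,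
        (fun j => X.cumWork ω (fun s => Q s ω) j t),
        fun j => X.departures ω (fun s => Q s ω) j t) j
      simp only [Realization.step] at hle ⊢
      generalize ∑ i, (X.realization ω).routed _ _ i j = r at h1 ⊢
      generalize ∑ i, X.cumRouted ω i j _ = c at h0 h1
      omega
    · ext j
      simp only [Realization.step]
      rw [hk]
    · ext j
      simp only [Realization.step]
      rw [hd]

end Primitives

end SwitchedNetwork

/-! ### Independence of used and unused primitives, and the Markov property -/

theorem measure_eq_tsum_inter_fiber {Ω ι : Type*} [MeasurableSpace Ω] [Countable ι]
    [MeasurableSpace ι] [MeasurableSingletonClass ι] (μ : Measure Ω) {g : Ω → ι}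
    (hg : Measurable g) {S : Set Ω} (hS : MeasurableSet S) :
    μ S = ∑' i, μ (S ∩ g ⁻¹' {i}) := by
  rw [← measure_iUnion]
  · have : ⋃ i, g ⁻¹' {i} = Set.univ := by ext; simp
    rw [← Set.inter_iUnion, this, Set.inter_univ]
  · intro i j hij
    refine Disjoint.inter_left' _ (Disjoint.inter_right' _ ?_)
    exact Disjoint.preimage g (by simpa using hij)
  · exact fun i => hS.inter (hg (measurableSet_singleton i))

theorem iIndep_mono {Ω ι : Type*} {m m' : ι → MeasurableSpace Ω} [MeasurableSpace Ω]
    {μ : Measure Ω} (h : iIndep m μ) (hle : ∀ i, m' i ≤ m i) : iIndep m' μ := by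
  rw [iIndep_iff] at h ⊢
  exact fun s f hf => h s fun i hi => hle i _ (hf i hi)

theorem map_eq_map_of_prob_true_eq {Ω : Type*} [MeasurableSpace Ω] {μ : Measure Ω}
    [IsProbabilityMeasure μ] {f g : Ω → Bool} (hf : Measurable f) (hg : Measurable g)
    (h : μ {ω | f ω = true} = μ {ω | g ω = true}) : μ.map f = μ.map g := by
  have hf' := Measure.isProbabilityMeasure_map (μ := μ) hf.aemeasurable
  have hg' := Measure.isProbabilityMeasure_map (μ := μ) hg.aemeasurable
  have ht : μ.map f {true} = μ.map g {true} := by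
    rw [Measure.map_apply hf (measurableSet_singleton _),
      Measure.map_apply hg (measurableSet_singleton _)]
    exact h
  refine Measure.ext_of_singleton fun b => ?_
  cases b
  · have : ({false} : Set Bool) = {true}ᶜ := by ext b; cases b <;> simp
    rw [this, prob_compl_eq_one_sub (measurableSet_singleton _),
      prob_compl_eq_one_sub (measurableSet_singleton _), ht]
  · exact ht

namespace SwitchedNetwork

variable {J : Type*} [Fintype J] [DecidableEq J]

theorem map_eq_map_of_prob_some_eq {Ω : Type*} [MeasurableSpace Ω] {μ : Measure Ω}
    [IsProbabilityMeasure μ] {f g : Ω → Option J} (hf : Measurable f) (hg : Measurable g)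
    (h : ∀ j, μ {ω | f ω = some j} = μ {ω | g ω = some j}) : μ.map f = μ.map g := by
  have hf' := Measure.isProbabilityMeasure_map (μ := μ) hf.aemeasurable
  have hg' := Measure.isProbabilityMeasure_map (μ := μ) hg.aemeasurable
  have hs : ∀ j, μ.map f {some j} = μ.map g {some j} := by
    intro j
    rw [Measure.map_apply hf (measurableSet_singleton _),
      Measure.map_apply hg (measurableSet_singleton _)]
    exact h j
  refine Measure.ext_of_singleton fun b => ?_
  cases b with
  | none =>
    have hc : ({none} : Set (Option J)) = ((Finset.univ.image some : Finset (Option J)) : Set _)ᶜ := by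
      ext b; cases b <;> simp
    rw [hc, prob_compl_eq_one_sub (Finset.measurableSet _),
      prob_compl_eq_one_sub (Finset.measurableSet _), ← sum_measure_singleton,
      ← sum_measure_singleton]
    congr 1
    refine Finset.sum_congr rfl fun b hb => ?_
    obtain ⟨j, _, rfl⟩ := Finset.mem_image.mp hb
    exact hs j
  | some j => exact hs j

namespace Primitives.IsDriving

open Realization

variable {Ω : Type*} [mΩ : MeasurableSpace Ω] {μ : Measure Ω} [IsProbabilityMeasure μ]
  {N : SwitchedNetwork J} {X : Primitives J Ω} (hX : X.IsDriving N μ)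
include hX

theorem measurable_arrival (j : J) (t : ℕ) : Measurable (X.arrival j t) :=
  (comap_measurable _).mono (hX.measurable (.arrival j t)) le_rfl

theorem measurable_service (j : J) (t : ℕ) : Measurable (X.service j t) :=
  (comap_measurable _).mono (hX.measurable (.service j t)) le_rfl

theorem measurable_routing (j : J) (t : ℕ) : Measurable (X.routing j t) :=
  (comap_measurable _).mono (hX.measurable (.routing j t)) le_rfl

theorem measurable_rule (t : ℕ) : Measurable (X.rule t) :=
  (comap_measurable _).mono (hX.measurable (.rule t)) le_rfl

omit hX mΩ in
theorem measurable_sigma_realization (i : PrimitiveIndex J) :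
    Measurable[X.sigma i] fun ω => X.realization ω i := by
  rcases i with ⟨j, t⟩ | ⟨j, t⟩ | ⟨j, t⟩ | t
  · have h : Measurable[X.sigma (.arrival j t)] (X.arrival j t) := comap_measurable _
    exact (by fun_prop : Measurable fun n : ℕ => ((n, false, none, 0) : PrimitiveValue J)).comp h
  · have h : Measurable[X.sigma (.service j t)] (X.service j t) := comap_measurable _
    exact (by fun_prop : Measurable fun n : Bool => ((0, n, none, 0) : PrimitiveValue J)).comp h
  · have h : Measurable[X.sigma (.routing j t)] (X.routing j t) := comap_measurable _
    exact (by fun_prop : Measurable fun n : Option J => ((0, false, n, 0) : PrimitiveValue J)).comp h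
  · have h : Measurable[X.sigma (.rule t)] (X.rule t) := comap_measurable _
    exact (by fun_prop : Measurable fun n : (J → ℕ) → (J → ℕ) =>
      ((0, false, none, n) : PrimitiveValue J)).comp h

theorem measurable_realization (i : PrimitiveIndex J) :
    Measurable fun ω => X.realization ω i :=
  (measurable_sigma_realization i).mono (hX.measurable i) le_rfl

theorem iIndepFun_realization : iIndepFun (fun i ω => X.realization ω i) μ :=
  iIndep_mono hX.indep fun i => (measurable_sigma_realization i).comap_le

theorem map_realization_shiftIndex (t : ℕ) (k d : J → ℕ) (i : PrimitiveIndex J) :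
    μ.map (fun ω => X.realization ω (shiftIndex t k d i)) = μ.map fun ω => X.realization ω i := by
  rcases i with ⟨j, s⟩ | ⟨j, s⟩ | ⟨j, s⟩ | s
  · have hm : Measurable fun n : ℕ => ((n, false, none, 0) : PrimitiveValue J) := by fun_prop
    have h := congrArg (Measure.map fun n : ℕ => ((n, false, none, 0) : PrimitiveValue J))
      ((hX.arrival_law j (t + s)).trans (hX.arrival_law j s).symm)
    rwa [Measure.map_map hm (hX.measurable_arrival j _),
      Measure.map_map hm (hX.measurable_arrival j _)] at h
  · have hm : Measurable fun n : Bool => ((0, n, none, 0) : PrimitiveValue J) := by fun_prop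
    have h := congrArg (Measure.map fun n : Bool => ((0, n, none, 0) : PrimitiveValue J))
      (map_eq_map_of_prob_true_eq (hX.measurable_service j (k j + s)) (hX.measurable_service j s)
        ((hX.service_law j _).trans (hX.service_law j s).symm))
    rwa [Measure.map_map hm (hX.measurable_service j _),
      Measure.map_map hm (hX.measurable_service j _)] at h
  · have hm : Measurable fun n : Option J => ((0, false, n, 0) : PrimitiveValue J) := by fun_prop
    have h := congrArg (Measure.map fun n : Option J => ((0, false, n, 0) : PrimitiveValue J))
      (map_eq_map_of_prob_some_eq (hX.measurable_routing j (d j + s)) (hX.measurable_routing j s)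
        fun j' => (hX.routing_law j _ j').trans (hX.routing_law j s j').symm)
    rwa [Measure.map_map hm (hX.measurable_routing j _),
      Measure.map_map hm (hX.measurable_routing j _)] at h
  · have hm : Measurable fun n : (J → ℕ) → (J → ℕ) =>
      ((0, false, none, n) : PrimitiveValue J) := by fun_prop
    have h := congrArg (Measure.map fun n : (J → ℕ) → (J → ℕ) =>
      ((0, false, none, n) : PrimitiveValue J))
      ((hX.rule_law (t + s)).trans (hX.rule_law s).symm)
    rwa [Measure.map_map hm (hX.measurable_rule _), Measure.map_map hm (hX.measurable_rule _)] at h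

/-- The random elements that have not been used have the same joint law as all of them. -/
theorem map_realization_shift (t : ℕ) (k d : J → ℕ) :
    μ.map (fun ω i => X.realization ω (shiftIndex t k d i)) = μ.map X.realization := by
  have h1 := (iIndepFun_iff_map_fun_eq_infinitePi_map hX.measurable_realization).mp
    hX.iIndepFun_realization
  have h2 := (iIndepFun_iff_map_fun_eq_infinitePi_map
    fun i => hX.measurable_realization (shiftIndex t k d i)).mp
    (hX.iIndepFun_realization.precomp (shiftIndex_injective t k d))
  simp only [hX.map_realization_shiftIndex] at h2
  exact h2.trans h1.symm

/-- An event determined by the random elements that have been used is independent of one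
determined by the others. -/
theorem measure_inter_shift (t : ℕ) (k d : J → ℕ) {H C : Set (Realization J)}
    (hH : MeasurableSet H) (hC : MeasurableSet C)
    (hdet : ∀ z z' : Realization J, (∀ i ∈ usedIndices t k d, z i = z' i) → z ∈ H → z' ∈ H) :
    μ {ω | X.realization ω ∈ H ∧ (fun i => X.realization ω (shiftIndex t k d i)) ∈ C} =
      μ {ω | X.realization ω ∈ H} * μ {ω | X.realization ω ∈ C} := by
  classical
  set U := usedIndices t k d
  -- Masking the coordinates outside `U` by a constant gives a map measurable with respect to the
  -- used primitives; `H` cannot tell it from the realization.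
  set r : Ω → Realization J := fun ω i => if i ∈ U then X.realization ω i else (0, false, none, 0)
    with hr
  have hrH : ∀ ω, X.realization ω ∈ H ↔ r ω ∈ H := fun ω =>
    ⟨fun h => hdet _ _ (fun i hi => by simp only [hr]; rw [if_pos hi]) h,
      fun h => hdet _ _ (fun i hi => by simp only [hr]; rw [if_pos hi]) h⟩
  have hind := indep_iSup_of_disjoint hX.measurable hX.indep (disjoint_usedIndices t k d)
  have hmr : Measurable[⨆ i ∈ U, X.sigma i] r := by
    refine @measurable_pi_lambda _ _ _ (_) _ _ fun i => ?_
    by_cases hi : i ∈ U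
    · simp only [hr, if_pos hi]
      exact (measurable_sigma_realization i).mono (le_iSup₂_of_le i hi le_rfl) le_rfl
    · simp only [hr, if_neg hi]
      exact measurable_const
  have hms : Measurable[⨆ i ∈ Set.range (shiftIndex t k d), X.sigma i]
      fun ω i => X.realization ω (shiftIndex t k d i) := by
    refine @measurable_pi_lambda _ _ _ (_) _ _ fun i => ?_
    exact (measurable_sigma_realization _).mono
      (le_iSup₂_of_le (shiftIndex t k d i) ⟨i, rfl⟩ le_rfl) le_rfl
  have h := (Indep_iff _ _ μ).mp hind (r ⁻¹' H) _ (hmr hH) (hms hC)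
  have hlaw : μ.map (fun ω i => X.realization ω (shiftIndex t k d i)) C =
      μ.map X.realization C := by rw [hX.map_realization_shift]
  rw [Measure.map_apply (measurable_pi_lambda _ fun i => hX.measurable_realization _) hC,
    Measure.map_apply (measurable_pi_lambda _ hX.measurable_realization) hC] at hlaw
  simp only [hrH]
  exact h.trans (by rw [hlaw]; rfl)

/-- The primitives used by time t form a random set, determined by the cumulative work k and
departures d. On each piece where (k, d) is fixed, the history is an event in a deterministic set of
primitives and the next state is a first step driven by the shifted family; the pieces are then
summed. -/
theorem isMarkovChain {Q : (J → ℕ) → ℕ → Ω → J → ℕ}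
    (hQ : ∀ x, X.IsQueueingNetworkSolution x (Q x)) : IsMarkovChain μ Q := by
  have hrun : ∀ x t ω, Q x t ω = ((X.realization ω).run x t).1 := fun x t ω => by
    rw [X.run_eq_of_isQueueingNetworkSolution (hQ x)]
  have hmrun : ∀ x t, Measurable fun ω => (X.realization ω).run x t := fun x t =>
    measurable_run hX.measurable_realization x t
  have hmz : ∀ x t, Measurable fun z : Realization J => z.run x t := fun x t =>
    measurable_run measurable_pi_apply x t
  have hmeas : ∀ x t, Measurable (Q x t) := fun x t => by
    have : Q x t = fun ω => ((X.realization ω).run x t).1 := funext (hrun x t)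
    rw [this]
    exact (hmrun x t).fst
  refine ⟨hmeas, fun x => (hQ x).init, fun x t h y => ?_⟩
  have hm1 : MeasurableSet {ω | ∀ s ≤ t, Q x s ω = h s} := by
    have : {ω | ∀ s ≤ t, Q x s ω = h s} = ⋂ s, ⋂ (_ : s ≤ t), Q x s ⁻¹' {h s} := by
      ext ω; simp
    rw [this]
    exact MeasurableSet.iInter fun s => MeasurableSet.iInter fun _ =>
      hmeas x s (measurableSet_singleton _)
  have hm2 : MeasurableSet {ω | (∀ s ≤ t, Q x s ω = h s) ∧ Q x (t + 1) ω = y} :=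
    hm1.inter (hmeas x (t + 1) (measurableSet_singleton y))
  rw [measure_eq_tsum_inter_fiber μ (hmrun x t).snd hm2,
    measure_eq_tsum_inter_fiber μ (hmrun x t).snd hm1, ← ENNReal.tsum_mul_right]
  congr 1
  ext ⟨k, d⟩
  set H : Set (Realization J) := {z | (∀ s ≤ t, (z.run x s).1 = h s) ∧ (z.run x t).2 = (k, d)}
    with hH
  set C : Set (Realization J) := {z | (z.run (h t) 1).1 = y} with hC
  have hmH : MeasurableSet H := by
    have : H = (⋂ s, ⋂ (_ : s ≤ t), (fun z => (z.run x s).1) ⁻¹' {h s}) ∩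
        (fun z => (z.run x t).2) ⁻¹' {(k, d)} := by
      ext ω; simp [hH]
    rw [this]
    exact (MeasurableSet.iInter fun s => MeasurableSet.iInter fun _ =>
      (hmz x s).fst (measurableSet_singleton _)).inter ((hmz x t).snd (measurableSet_singleton _))
  have hmC : MeasurableSet C := (hmz (h t) 1).fst (measurableSet_singleton y)
  have hdet : ∀ z z' : Realization J, (∀ i ∈ usedIndices t k d, z i = z' i) → z ∈ H → z' ∈ H := by
    intro z z' hzz hz
    have hz2 : (z.run x t).2 = (k, d) := hz.2
    have hU : z.usedBy x t = usedIndices t k d := by rw [usedBy, hz2]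
    have heq : ∀ s ≤ t, z.run x s = z'.run x s := fun s hs =>
      run_congr x s fun i hi => hzz i (hU ▸ z.usedBy_mono x hs hi)
    refine ⟨fun s hs => ?_, ?_⟩
    · rw [← heq s hs]; exact hz.1 s hs
    · rw [← heq t le_rfl]; exact hz2
  have key := hX.measure_inter_shift t k d hmH hmC hdet
  have e1 : {ω | (∀ s ≤ t, Q x s ω = h s) ∧ Q x (t + 1) ω = y} ∩
      (fun ω => ((X.realization ω).run x t).2) ⁻¹' {(k, d)} =
      {ω | X.realization ω ∈ H ∧ (fun i => X.realization ω (shiftIndex t k d i)) ∈ C} := by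
    ext ω
    have hstep : (X.realization ω).run x t = (h t, k, d) → (Q x (t + 1) ω = y ↔
        (fun i => X.realization ω (shiftIndex t k d i)) ∈ C) := by
      intro hst
      rw [hrun]
      change ((X.realization ω).step t ((X.realization ω).run x t)).1 = y ↔ _
      rw [hst, step_fst_eq_run_shift]
      rfl
    constructor
    · rintro ⟨⟨h1, h2⟩, h3⟩
      have hin : X.realization ω ∈ H := ⟨fun s hs => by rw [← hrun]; exact h1 s hs, h3⟩
      exact ⟨hin, (hstep (Prod.ext (hin.1 t le_rfl) hin.2)).mp h2⟩
    · rintro ⟨h1, h2⟩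
      exact ⟨⟨fun s hs => by rw [hrun]; exact h1.1 s hs,
        (hstep (Prod.ext (h1.1 t le_rfl) h1.2)).mpr h2⟩, h1.2⟩
  have e2 : {ω | ∀ s ≤ t, Q x s ω = h s} ∩
      (fun ω => ((X.realization ω).run x t).2) ⁻¹' {(k, d)} = {ω | X.realization ω ∈ H} := by
    ext ω
    simp only [hrun]
    rfl
  have e3 : {ω | Q (h t) 1 ω = y} = {ω | X.realization ω ∈ C} := by
    ext ω
    simp only [hrun]
    rfl
  rw [e1, e2, e3]
  exact key

end Primitives.IsDriving

end SwitchedNetwork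

/-! ### Laws of large numbers in mean -/

section Fluctuations

open Filter Topology

/-- The maximum of `|b 0|, …, |b n|`. -/
noncomputable def maxAbs (b : ℕ → ℝ) (n : ℕ) : ℝ :=
  (Finset.range (n + 1)).sup' ⟨0, by simp⟩ fun u => |b u|

theorem abs_le_maxAbs (b : ℕ → ℝ) {u n : ℕ} (h : u ≤ n) : |b u| ≤ maxAbs b n :=
  Finset.le_sup' (fun u => |b u|) (Finset.mem_range.mpr (Nat.lt_succ_of_le h))

theorem maxAbs_le {b : ℕ → ℝ} {n : ℕ} {c : ℝ} (h : ∀ u ≤ n, |b u| ≤ c) : maxAbs b n ≤ c :=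
  Finset.sup'_le _ _ fun u hu => h u (Nat.lt_succ_iff.mp (Finset.mem_range.mp hu))

theorem maxAbs_nonneg (b : ℕ → ℝ) (n : ℕ) : 0 ≤ maxAbs b n :=
  (abs_nonneg _).trans (abs_le_maxAbs b (Nat.zero_le n))

/-- Terms beyond a fixed K are at most a small multiple of n, and the first ones contribute a
constant. The running maximum is needed because services and routings are counted up to random
indices. -/
theorem tendsto_maxAbs_div {b : ℕ → ℝ} (h : Tendsto (fun u : ℕ => b u / u) atTop (𝓝 0)) :
    Tendsto (fun n : ℕ => maxAbs b n / n) atTop (𝓝 0) := by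
  rw [Metric.tendsto_atTop] at h ⊢
  intro ε hε
  obtain ⟨K, hK⟩ := h (ε / 2) (half_pos hε)
  obtain ⟨L, hL⟩ := exists_nat_gt (maxAbs b K / (ε / 2))
  refine ⟨max L 1, fun n hn => ?_⟩
  have hn1 : 1 ≤ n := (le_max_right _ _).trans hn
  have hn0 : (0 : ℝ) < n := by exact_mod_cast hn1
  have hLn : (L : ℝ) ≤ n := by exact_mod_cast (le_max_left _ _).trans hn
  have hKn : maxAbs b K < ε / 2 * n := by
    rw [div_lt_iff₀ (half_pos hε)] at hL
    nlinarith
  rw [Real.dist_eq, sub_zero, abs_of_nonneg (div_nonneg (maxAbs_nonneg _ _) hn0.le),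
    div_lt_iff₀ hn0]
  have hle : maxAbs b n ≤ ε / 2 * n := by
    refine maxAbs_le fun u hu => ?_
    have hun : (u : ℝ) ≤ n := by exact_mod_cast hu
    rcases le_or_gt u K with huK | huK
    · exact (abs_le_maxAbs b huK).trans hKn.le
    · have hu0 : (0 : ℝ) < u := by exact_mod_cast (Nat.zero_le K).trans_lt huK
      have := hK u huK.le
      rw [Real.dist_eq, sub_zero, abs_div, abs_of_pos hu0, div_lt_iff₀ hu0] at this
      nlinarith
  nlinarith

variable {Ω : Type*} [MeasurableSpace Ω] {μ : Measure Ω}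

theorem measurable_maxAbs {b : ℕ → Ω → ℝ} (hb : ∀ u, Measurable (b u)) (n : ℕ) :
    Measurable fun ω => maxAbs (fun u => b u ω) n := by
  have h := Finset.measurable_sup' (s := Finset.range (n + 1)) ⟨0, by simp⟩
    (f := fun u ω => |b u ω|) fun u _ => (hb u).abs
  convert h using 1
  ext ω
  exact (Finset.sup'_apply (C := fun _ : Ω => ℝ) _ (fun u ω => |b u ω|) ω).symm

variable [IsProbabilityMeasure μ]

theorem abs_sum_sub_le {y : ℕ → ℝ} {m : ℝ} (hy : ∀ k, y k ∈ Set.Icc (0 : ℝ) 1)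
    (hm : m ∈ Set.Icc (0 : ℝ) 1) (u : ℕ) : |∑ k ∈ Finset.range u, y k - u * m| ≤ u := by
  have h0 : 0 ≤ ∑ k ∈ Finset.range u, y k := Finset.sum_nonneg fun k _ => (hy k).1
  have h1 : ∑ k ∈ Finset.range u, y k ≤ u := by
    calc _ ≤ ∑ k ∈ Finset.range u, (1 : ℝ) := Finset.sum_le_sum fun k _ => (hy k).2
      _ = u := by simp
  have hu : (0 : ℝ) ≤ u := Nat.cast_nonneg u
  rw [abs_le]
  constructor <;> nlinarith [hm.1, hm.2]

/-- The fluctuations of the partial sums of bounded i.i.d. random variables, maximized over an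
initial segment, are sublinear in the mean. -/
theorem tendsto_integral_maxAbs_div {Y : ℕ → Ω → ℝ} {m : ℝ} (hmeas : ∀ k, Measurable (Y k))
    (hY : ∀ k ω, Y k ω ∈ Set.Icc (0 : ℝ) 1)
    (hindep : Pairwise (Function.onFun (fun f g => IndepFun f g μ) Y))
    (hident : ∀ k, IdentDistrib (Y k) (Y 0) μ μ) (hm : ∫ ω, Y 0 ω ∂μ = m) :
    (∀ n, Integrable (fun ω => maxAbs (fun u => ∑ k ∈ Finset.range u, Y k ω - u * m) n) μ) ∧
    Tendsto (fun n : ℕ => (∫ ω, maxAbs (fun u => ∑ k ∈ Finset.range u, Y k ω - u * m) n ∂μ) / n)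
      atTop (𝓝 0) := by
  have hint : Integrable (Y 0) μ :=
    Integrable.of_bound (hmeas 0).aestronglyMeasurable 1 (Eventually.of_forall fun ω => by
      rw [Real.norm_eq_abs, abs_of_nonneg (hY 0 ω).1]; exact (hY 0 ω).2)
  have hm01 : m ∈ Set.Icc (0 : ℝ) 1 := by
    rw [← hm]
    refine ⟨integral_nonneg fun ω => (hY 0 ω).1, ?_⟩
    calc ∫ ω, Y 0 ω ∂μ ≤ ∫ _, (1 : ℝ) ∂μ :=
          integral_mono hint (integrable_const _) fun ω => (hY 0 ω).2
      _ = 1 := by simp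
  have hmb : ∀ n, Measurable fun ω => maxAbs (fun u => ∑ k ∈ Finset.range u, Y k ω - u * m) n :=
    measurable_maxAbs fun u => (Finset.measurable_sum _ fun k _ => hmeas k).sub measurable_const
  have hle : ∀ n ω, maxAbs (fun u => ∑ k ∈ Finset.range u, Y k ω - u * m) n ≤ n := fun n ω =>
    maxAbs_le fun u hu => (abs_sum_sub_le (fun k => hY k ω) hm01 u).trans (by exact_mod_cast hu)
  refine ⟨fun n => Integrable.of_bound (hmb n).aestronglyMeasurable n
    (Eventually.of_forall fun ω => ?_), ?_⟩
  · rw [Real.norm_eq_abs, abs_of_nonneg (maxAbs_nonneg _ _)]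
    exact hle n ω
  · have hae : ∀ᵐ ω ∂μ, Tendsto
        (fun n : ℕ => maxAbs (fun u => ∑ k ∈ Finset.range u, Y k ω - u * m) n / n) atTop (𝓝 0) := by
      filter_upwards [strong_law_ae_real Y hint hindep hident] with ω hω
      refine tendsto_maxAbs_div ?_
      rw [hm] at hω
      have h2 := hω.sub_const m
      rw [sub_self] at h2
      refine h2.congr' ?_
      filter_upwards [eventually_gt_atTop 0] with u hu
      have : (u : ℝ) ≠ 0 := by exact_mod_cast hu.ne'
      field_simp
    -- Variables in [0, 1] give deviations of at most n, so 1 dominates the quotient.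
    have h := tendsto_integral_of_dominated_convergence (μ := μ) (fun _ => (1 : ℝ))
      (F := fun (n : ℕ) ω => maxAbs (fun u => ∑ k ∈ Finset.range u, Y k ω - u * m) n / n)
      (f := fun _ => 0) (fun n => ((hmb n).div_const _).aestronglyMeasurable)
      (integrable_const _) (fun n => Eventually.of_forall fun ω => ?_) hae
    · simpa [integral_div] using h
    · rw [Real.norm_eq_abs, abs_of_nonneg (div_nonneg (maxAbs_nonneg _ _) (Nat.cast_nonneg n))]
      exact div_le_one_of_le₀ (hle n ω) (Nat.cast_nonneg n)

/-- For arrivals, which have only a finite mean, the L¹ law of large numbers is enough: they are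
counted up to deterministic times. -/
theorem tendsto_integral_abs_sum_sub_div {Y : ℕ → Ω → ℝ} {m : ℝ} (hint : Integrable (Y 0) μ)
    (hindep : Pairwise (Function.onFun (fun f g => IndepFun f g μ) Y))
    (hident : ∀ k, IdentDistrib (Y k) (Y 0) μ μ) (hm : ∫ ω, Y 0 ω ∂μ = m) :
    Tendsto (fun n : ℕ => (∫ ω, |∑ k ∈ Finset.range n, Y k ω - n * m| ∂μ) / n) atTop (𝓝 0) := by
  have h := strong_law_Lp (p := 1) le_rfl ENNReal.one_ne_top Y (memLp_one_iff_integrable.mpr hint)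
    hindep hident
  have h2 := (ENNReal.tendsto_toReal ENNReal.zero_ne_top).comp h
  rw [ENNReal.toReal_zero] at h2
  refine h2.congr' ?_
  filter_upwards [eventually_gt_atTop 0] with n hn
  have hn0 : (0 : ℝ) < n := by exact_mod_cast hn
  have hYint : ∀ k, Integrable (Y k) μ := fun k => (hident k).integrable_iff.mpr hint
  have hS : Integrable (fun ω => (n : ℝ)⁻¹ • ∑ i ∈ Finset.range n, Y i ω - ∫ x, Y 0 x ∂μ) μ :=
    Integrable.sub ((integrable_finsetSum _ fun k _ => hYint k).smul (n : ℝ)⁻¹)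
      (integrable_const _)
  simp only [Function.comp_apply]
  rw [eLpNorm_one_eq_lintegral_enorm, ← integral_norm_eq_lintegral_enorm hS.aestronglyMeasurable,
    ← integral_div]
  congr 1
  ext ω
  rw [Real.norm_eq_abs, hm, smul_eq_mul, ← abs_of_pos hn0, ← abs_div, abs_of_pos hn0]
  congr 1
  field_simp

end Fluctuations

namespace SwitchedNetwork.Primitives

variable {J Ω : Type*} (X : Primitives J Ω)

theorem cumArrival_eq (j : J) (T : ℕ) (ω : Ω) :
    (X.cumArrival ω j T : ℝ) = ∑ s ∈ Finset.range T, (X.arrival j s ω : ℝ) := by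
  simp [cumArrival]

theorem cumServed_eq (j : J) (u : ℕ) (ω : Ω) : (X.cumServed ω j u : ℝ) =
    ∑ k ∈ Finset.range u, if X.service j k ω = true then (1 : ℝ) else 0 := by
  simp [cumServed]

theorem cumRouted_eq [DecidableEq J] (i j : J) (u : ℕ) (ω : Ω) : (X.cumRouted ω i j u : ℝ) =
    ∑ k ∈ Finset.range u, if X.routing i k ω = some j then (1 : ℝ) else 0 := by
  simp [cumRouted]

end SwitchedNetwork.Primitives

namespace SwitchedNetwork.Primitives.IsDriving

open Filter Topology

variable {J : Type*} [Fintype J] [DecidableEq J] {Ω : Type*} [mΩ : MeasurableSpace Ω]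
  {μ : Measure Ω} [IsProbabilityMeasure μ]
  {N : SwitchedNetwork J} {X : Primitives J Ω} (hX : X.IsDriving N μ)
include hX

theorem integrable_arrival (j : J) (t : ℕ) : Integrable (fun ω => (X.arrival j t ω : ℝ)) μ := by
  have h := N.arrival_integrable j
  rw [← hX.arrival_law j t] at h
  exact (integrable_map_measure Measurable.of_discrete.aestronglyMeasurable
    (hX.measurable_arrival j t).aemeasurable).mp h

theorem integral_arrival (j : J) (t : ℕ) : ∫ ω, (X.arrival j t ω : ℝ) ∂μ = N.meanArrival j := by
  rw [meanArrival, ← hX.arrival_law j t, integral_map (hX.measurable_arrival j t).aemeasurable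
    Measurable.of_discrete.aestronglyMeasurable]

theorem integrable_cumArrival (j : J) (T : ℕ) :
    Integrable (fun ω => (X.cumArrival ω j T : ℝ)) μ := by
  simp only [cumArrival_eq]
  exact integrable_finsetSum _ fun s _ => hX.integrable_arrival j s

theorem integral_cumArrival (j : J) (T : ℕ) :
    ∫ ω, (X.cumArrival ω j T : ℝ) ∂μ = T * N.meanArrival j := by
  simp only [cumArrival_eq]
  rw [integral_finsetSum _ fun s _ => hX.integrable_arrival j s]
  simp [hX.integral_arrival]

theorem tendsto_cumArrival (j : J) :
    Tendsto (fun T : ℕ => (∫ ω, |(X.cumArrival ω j T : ℝ) - T * N.meanArrival j| ∂μ) / T)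
      atTop (𝓝 0) := by
  simp only [cumArrival_eq]
  have hm : Measurable fun n : ℕ => (n : ℝ) := Measurable.of_discrete
  refine tendsto_integral_abs_sum_sub_div (Y := fun s ω => (X.arrival j s ω : ℝ))
    (hX.integrable_arrival j 0) (fun s s' hs => ?_) (fun s => ?_) (hX.integral_arrival j 0)
  · have : IndepFun (X.arrival j s) (X.arrival j s') μ :=
      hX.indep.indep (i := .arrival j s) (j := .arrival j s') (by simpa using hs)
    exact this.comp hm hm
  · have : IdentDistrib (X.arrival j s) (X.arrival j 0) μ μ :=
      ⟨(hX.measurable_arrival j s).aemeasurable, (hX.measurable_arrival j 0).aemeasurable,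
        (hX.arrival_law j s).trans (hX.arrival_law j 0).symm⟩
    exact this.comp hm

theorem fluctuation_cumServed (j : J) :
    (∀ n, Integrable (fun ω => maxAbs (fun u => (X.cumServed ω j u : ℝ) - u * N.p j) n) μ) ∧
    Tendsto (fun n : ℕ => (∫ ω, maxAbs (fun u => (X.cumServed ω j u : ℝ) - u * N.p j) n ∂μ) / n)
      atTop (𝓝 0) := by
  simp only [cumServed_eq]
  have hm : Measurable fun b : Bool => if b = true then (1 : ℝ) else 0 := Measurable.of_discrete
  refine tendsto_integral_maxAbs_div
    (Y := fun k ω => if X.service j k ω = true then (1 : ℝ) else 0)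
    (fun k => hm.comp (hX.measurable_service j k)) (fun k ω => ?_) (fun s s' hs => ?_)
    (fun s => ?_) ?_
  · split_ifs <;> simp
  · have : IndepFun (X.service j s) (X.service j s') μ :=
      hX.indep.indep (i := .service j s) (j := .service j s') (by simpa using hs)
    exact this.comp hm hm
  · have : IdentDistrib (X.service j s) (X.service j 0) μ μ :=
      ⟨(hX.measurable_service j s).aemeasurable, (hX.measurable_service j 0).aemeasurable,
        map_eq_map_of_prob_true_eq (hX.measurable_service j s) (hX.measurable_service j 0)
          ((hX.service_law j s).trans (hX.service_law j 0).symm)⟩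
    exact this.comp hm
  · have hms : MeasurableSet {ω | X.service j 0 ω = true} :=
      hX.measurable_service j 0 (measurableSet_singleton true)
    have h := integral_indicator_const (μ := μ) (1 : ℝ) hms
    rw [measureReal_def, hX.service_law, ENNReal.toReal_ofReal (N.p_pos j).le] at h
    simpa [Set.indicator_apply] using h

theorem fluctuation_cumRouted (i j : J) :
    (∀ n, Integrable (fun ω => maxAbs (fun u => (X.cumRouted ω i j u : ℝ) - u * N.P i j) n) μ) ∧
    Tendsto
      (fun n : ℕ => (∫ ω, maxAbs (fun u => (X.cumRouted ω i j u : ℝ) - u * N.P i j) n ∂μ) / n)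
      atTop (𝓝 0) := by
  simp only [cumRouted_eq]
  have hm : Measurable fun b : Option J => if b = some j then (1 : ℝ) else 0 :=
    Measurable.of_discrete
  refine tendsto_integral_maxAbs_div
    (Y := fun k ω => if X.routing i k ω = some j then (1 : ℝ) else 0)
    (fun k => hm.comp (hX.measurable_routing i k)) (fun k ω => ?_) (fun s s' hs => ?_)
    (fun s => ?_) ?_
  · split_ifs <;> simp
  · have : IndepFun (X.routing i s) (X.routing i s') μ :=
      hX.indep.indep (i := .routing i s) (j := .routing i s') (by simpa using hs)
    exact this.comp hm hm
  · have : IdentDistrib (X.routing i s) (X.routing i 0) μ μ :=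
      ⟨(hX.measurable_routing i s).aemeasurable, (hX.measurable_routing i 0).aemeasurable,
        map_eq_map_of_prob_some_eq (hX.measurable_routing i s) (hX.measurable_routing i 0)
          fun j' => (hX.routing_law i s j').trans (hX.routing_law i 0 j').symm⟩
    exact this.comp hm
  · have hms : MeasurableSet {ω | X.routing i 0 ω = some j} :=
      hX.measurable_routing i 0 (measurableSet_singleton (some j))
    have h := integral_indicator_const (μ := μ) (1 : ℝ) hms
    rw [measureReal_def, hX.routing_law, ENNReal.toReal_ofReal (N.P_nonneg i j)] at h
    simpa [Set.indicator_apply] using h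

end SwitchedNetwork.Primitives.IsDriving

/-! ### A matrix game with positive value -/

section Minimax

theorem exists_pos_forall_le {ι : Type*} [Finite ι] {f : ι → ℝ} (hf : ∀ i, 0 < f i) :
    ∃ δ > 0, ∀ i, δ ≤ f i := by
  rcases isEmpty_or_nonempty ι with h | h
  · exact ⟨1, one_pos, fun i => h.elim i⟩
  · obtain ⟨i, hi⟩ := Finite.exists_min f
    exact ⟨f i, hf i, hi⟩

open Filter Topology in
/-- A matrix game whose payoff matrix is strictly copositive has a positive value, and this is
guaranteed by a strategy with full support. -/
theorem exists_fullSupport_strategy {ι : Type*} [Fintype ι] [Nonempty ι] (m : ι → ι → ℝ)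
    (hm : ∀ β ∈ stdSimplex ℝ ι, 0 < ∑ i, ∑ k, β i * β k * m i k) :
    ∃ α : ι → ℝ, (∀ i, 0 < α i) ∧ ∑ i, α i = 1 ∧ ∀ k, 0 < ∑ i, α i * m i k := by
  classical
  set L : (ι → ℝ) → (ι → ℝ) := fun β i => ∑ k, m i k * β k with hL
  have hLlin : IsLinearMap ℝ L := by
    constructor
    · intro x y; ext i
      simp only [hL, Pi.add_apply, mul_add, Finset.sum_add_distrib]
    · intro c x; ext i
      simp only [hL, Pi.smul_apply, smul_eq_mul, Finset.mul_sum]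
      exact Finset.sum_congr rfl fun k _ => by ring
  have hLcont : Continuous L := by fun_prop
  set t : Set (ι → ℝ) := {z | ∀ i, z i ≤ 0} with ht
  have htconv : Convex ℝ t := by
    intro x hx y hy a b ha hb _ i
    simp only [Pi.add_apply, Pi.smul_apply, smul_eq_mul]
    nlinarith [hx i, hy i]
  have htclosed : IsClosed t := by
    rw [ht, Set.ofPred_forall]
    exact isClosed_iInter fun i => isClosed_le (continuous_apply i) continuous_const
  -- If all entries of L β were nonpositive, so would be their β-average, which is the quadratic
  -- form at β.
  have hdisj : Disjoint (L '' stdSimplex ℝ ι) t := by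
    rw [Set.disjoint_left]
    rintro _ ⟨β, hβ, rfl⟩ h
    have h1 := hm β hβ
    have h2 : ∑ i, ∑ k, β i * β k * m i k = ∑ i, β i * L β i := by
      refine Finset.sum_congr rfl fun i _ => ?_
      rw [hL, Finset.mul_sum]
      exact Finset.sum_congr rfl fun k _ => by ring
    rw [h2] at h1
    exact absurd h1 (not_lt.mpr (Finset.sum_nonpos fun i _ =>
      mul_nonpos_of_nonneg_of_nonpos (hβ.1 i) (h i)))
  obtain ⟨f, u, v, hfu, huv, hfv⟩ := geometric_hahn_banach_compact_closed
    ((convex_stdSimplex ℝ ι).is_linear_image hLlin) ((isCompact_stdSimplex ℝ ι).image hLcont)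
    htconv htclosed hdisj
  have hv0 : v < 0 := by simpa using hfv 0 (fun i => le_rfl)
  -- Otherwise a negative multiple of the basis vector, still in `t`, would attain the value v.
  -- Hence the negated coefficients of f are nonnegative weights.
  have hfe : ∀ i, f (Pi.single i 1) ≤ 0 := by
    intro i
    by_contra! hpos
    have hmem : (v / f (Pi.single i 1)) • (Pi.single i (1 : ℝ) : ι → ℝ) ∈ t := by
      intro k
      rw [Pi.smul_apply, smul_eq_mul]
      refine mul_nonpos_of_nonpos_of_nonneg (div_neg_of_neg_of_pos hv0 hpos).le ?_
      by_cases hk : k = i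
      · subst hk; simp
      · simp [hk]
    have := hfv _ hmem
    rw [map_smul, smul_eq_mul, div_mul_cancel₀ _ hpos.ne'] at this
    exact lt_irrefl _ this
  have hfsum : ∀ z : ι → ℝ, f z = ∑ i, z i * f (Pi.single i 1) := by
    intro z
    conv_lhs => rw [pi_eq_sum_univ' z]
    rw [map_sum]
    refine Finset.sum_congr rfl fun i _ => ?_
    rw [map_smul, smul_eq_mul]
  have hval : ∀ k, 0 < ∑ i, (-f (Pi.single i 1)) * m i k := by
    intro k
    have hmem : L (Pi.single k 1) ∈ L '' stdSimplex ℝ ι := ⟨_, single_mem_stdSimplex ℝ k, rfl⟩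
    have h1 := hfu _ hmem
    rw [hfsum] at h1
    have h2 : ∀ i, L (Pi.single k 1) i = m i k := by
      intro i
      simp [hL, Pi.single_apply]
    simp only [h2] at h1
    have : ∑ i, (-f (Pi.single i 1)) * m i k = -∑ i, m i k * f (Pi.single i 1) := by
      rw [← Finset.sum_neg_distrib]
      exact Finset.sum_congr rfl fun i _ => by ring
    rw [this]
    linarith
  -- Adding a small ε to each weight gives full support and keeps the finitely many strict
  -- inequalities.
  have hev : ∀ᶠ ε : ℝ in 𝓝[>] 0, ∀ k, 0 < ∑ i, (-f (Pi.single i 1) + ε) * m i k := by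
    rw [eventually_all]
    intro k
    have hc : Continuous fun ε : ℝ => ∑ i, (-f (Pi.single i 1) + ε) * m i k := by fun_prop
    have h0 := hc.tendsto 0
    simp only [add_zero] at h0
    exact (h0.eventually (lt_mem_nhds (hval k))).filter_mono nhdsWithin_le_nhds
  obtain ⟨ε, hε, hε0⟩ := (hev.and self_mem_nhdsWithin).exists
  have hε0 : 0 < ε := hε0
  have hp : ∀ i, 0 < -f (Pi.single i 1) + ε := fun i => by linarith [hfe i]
  have hs : 0 < ∑ i, (-f (Pi.single i 1) + ε) := Finset.sum_pos (fun i _ => hp i) Finset.univ_nonempty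
  refine ⟨fun i => (-f (Pi.single i 1) + ε) / ∑ i, (-f (Pi.single i 1) + ε),
    fun i => div_pos (hp i) hs, ?_, fun k => ?_⟩
  · rw [← Finset.sum_div, div_self hs.ne']
  · have := div_pos (hε k) hs
    rw [Finset.sum_div] at this
    refine this.trans_le (le_of_eq (Finset.sum_congr rfl fun i _ => by ring))

end Minimax

/-! ### Bonuses that force near-optimal indices into the active set -/

section ActiveSets

/-- In a maximum of weighted means over sets of indices, in which large sets are favoured by
rapidly increasing bonuses, an optimal set contains all the indices with nearly maximal values. -/
theorem exists_bonus {ι : Type*} [Fintype ι] [DecidableEq ι] {w : ℝ} (hw : 0 < w) {η : ℝ}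
    (hη : 0 ≤ η) :
    ∃ (M : ℕ → ℝ) (K : ℝ), Monotone M ∧ 0 ≤ M 0 ∧ 0 ≤ K ∧
      ∀ (Fam : Set (Finset ι)) (α : Finset ι → ι → ℝ),
        (∀ F ∈ Fam, ∑ i ∈ F, α F i = 1 ∧ ∀ i ∈ F, w ≤ α F i) →
        ∀ (z : ι → ℝ) (i₀ : ι), (∀ i, z i ≤ z i₀) →
        (∀ F : Finset ι, F.Nonempty → (∀ i ∈ F, z i₀ - K ≤ z i) → F ∈ Fam) →
        ∀ F ∈ Fam, (∀ F' ∈ Fam, ∑ i ∈ F', α F' i * z i + M F'.card ≤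
          ∑ i ∈ F, α F i * z i + M F.card) →
        ∀ i, z i₀ - η ≤ z i → i ∈ F := by
  -- The increment M k / w + η + 1 exceeds the largest loss M k / w + η that a mean over k + 1
  -- nearly maximal indices can incur.
  let M : ℕ → ℝ := fun n => Nat.rec 0 (fun _ r => r * (1 + 1 / w) + η + 1) n
  have hM0 : M 0 = 0 := rfl
  have hMs : ∀ k, M (k + 1) = M k * (1 + 1 / w) + η + 1 := fun k => rfl
  have hMnn : ∀ k, 0 ≤ M k := by
    intro k
    induction k with
    | zero => exact hM0.ge
    | succ k ih => rw [hMs]; positivity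
  have hMmono : Monotone M := monotone_nat_of_le_succ fun k => by
    rw [hMs]
    have : 0 ≤ M k * (1 / w) := mul_nonneg (hMnn k) (by positivity)
    linarith
  refine ⟨M, M (Fintype.card ι) / w + η, hMmono, hM0.ge,
    add_nonneg (div_nonneg (hMnn _) hw.le) hη, ?_⟩
  intro Fam α hα z i₀ hz hFam F hF hmax i hi
  by_contra hiF
  have hgap : ∀ G ∈ Fam, ∑ k ∈ G, α G k * (z i₀ - z k) = z i₀ - ∑ k ∈ G, α G k * z k := by
    intro G hG
    simp only [mul_sub, Finset.sum_sub_distrib, ← Finset.sum_mul, (hα G hG).1, one_mul]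
  have hcard : M F.card ≤ M (Fintype.card ι) := hMmono (Finset.card_le_univ F)
  have hK : 0 ≤ M (Fintype.card ι) / w := div_nonneg (hMnn _) hw.le
  have hsing : ({i₀} : Finset ι) ∈ Fam := by
    refine hFam _ (Finset.singleton_nonempty _) fun k hk => ?_
    rw [Finset.mem_singleton.mp hk]
    linarith
  have h1 := hmax _ hsing
  have hα0 : α {i₀} i₀ = 1 := by simpa using (hα _ hsing).1
  rw [Finset.sum_singleton, hα0, one_mul, Finset.card_singleton] at h1
  -- Since F beats the singleton of i₀, its mean gap is at most M |F|; each index has weight at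
  -- least w.
  have hFgap : ∀ k ∈ F, z i₀ - z k ≤ M F.card / w := by
    intro k hk
    rw [le_div_iff₀ hw]
    have h2 : α F k * (z i₀ - z k) ≤ ∑ k ∈ F, α F k * (z i₀ - z k) :=
      Finset.single_le_sum (f := fun k => α F k * (z i₀ - z k)) (fun l hl =>
        mul_nonneg (hw.le.trans ((hα F hF).2 l hl)) (by linarith [hz l])) hk
    rw [hgap F hF] at h2
    have h3 : w * (z i₀ - z k) ≤ α F k * (z i₀ - z k) :=
      mul_le_mul_of_nonneg_right ((hα F hF).2 k hk) (by linarith [hz k])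
    linarith [hMnn 1]
  have hgap' : ∀ k ∈ insert i F, z i₀ - z k ≤ M F.card / w + η := by
    intro k hk
    rcases Finset.mem_insert.mp hk with rfl | hk
    · have := div_nonneg (hMnn F.card) hw.le
      linarith
    · linarith [hFgap k hk]
  -- The constant K is the largest gap that can occur here, so the enlarged set is admissible; its
  -- bonus then contradicts the optimality of F.
  have hF' : insert i F ∈ Fam := by
    refine hFam _ (Finset.insert_nonempty _ _) fun k hk => ?_
    have := hgap' k hk
    have : M F.card / w ≤ M (Fintype.card ι) / w := by gcongr
    linarith
  have h4 : ∑ k ∈ insert i F, α (insert i F) k * (z i₀ - z k) ≤ M F.card / w + η := by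
    calc _ ≤ ∑ k ∈ insert i F, α (insert i F) k * (M F.card / w + η) :=
          Finset.sum_le_sum fun k hk => mul_le_mul_of_nonneg_left (hgap' k hk)
            (hw.le.trans ((hα _ hF').2 k hk))
      _ = M F.card / w + η := by rw [← Finset.sum_mul, (hα _ hF').1, one_mul]
  rw [hgap _ hF'] at h4
  have h5 := hmax _ hF'
  rw [Finset.card_insert_of_notMem hiF, hMs] at h5
  have h6 : ∑ k ∈ F, α F k * z k ≤ z i₀ := by
    have : 0 ≤ ∑ k ∈ F, α F k * (z i₀ - z k) := Finset.sum_nonneg fun l hl =>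
      mul_nonneg (hw.le.trans ((hα F hF).2 l hl)) (by linarith [hz l])
    rw [hgap F hF] at this
    linarith
  have h7 : M F.card * (1 + 1 / w) = M F.card + M F.card / w := by ring
  linarith

end ActiveSets

/-! ### The drift form and the Lyapunov function -/

namespace SwitchedNetwork

variable {J : Type*} [Fintype J] [DecidableEq J] (N : SwitchedNetwork J)

/-- The excess of a schedule over the traffic intensity, in units of the latter. -/
noncomputable def excess (σ : J → ℕ) (j : J) : ℝ := σ j / N.trafficIntensity j - 1

/-- The bilinear form `v, y ↦ ∑ j, v j * (λ j * y j - ∑ i, λ i * y i * P i j)`. -/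
noncomputable def driftForm (v y : J → ℝ) : ℝ :=
  ∑ j, v j * (N.totalArrivalRate j * y j - ∑ i, N.totalArrivalRate i * y i * N.P i j)

theorem driftForm_sum_left {ι : Type*} (s : Finset ι) (β : ι → ℝ) (v : ι → J → ℝ) (y : J → ℝ) :
    N.driftForm (fun j => ∑ i ∈ s, β i * v i j) y = ∑ i ∈ s, β i * N.driftForm (v i) y := by
  simp only [driftForm, Finset.mul_sum, Finset.sum_mul]
  rw [Finset.sum_comm]
  exact Finset.sum_congr rfl fun i _ => Finset.sum_congr rfl fun j _ => by ring

theorem driftForm_sum_right {ι : Type*} (s : Finset ι) (β : ι → ℝ) (v : J → ℝ) (y : ι → J → ℝ) :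
    N.driftForm v (fun j => ∑ i ∈ s, β i * y i j) = ∑ i ∈ s, β i * N.driftForm v (y i) := by
  simp only [driftForm, Finset.mul_sum]
  rw [Finset.sum_comm]
  refine Finset.sum_congr rfl fun j _ => ?_
  have h1 : ∀ k, ∑ i ∈ s, N.totalArrivalRate k * (β i * y i k) =
      N.totalArrivalRate k * ∑ i ∈ s, β i * y i k := fun k => by rw [Finset.mul_sum]
  have h2 : ∑ x, N.totalArrivalRate x * (∑ i ∈ s, β i * y i x) * N.P x j =
      ∑ i ∈ s, β i * ∑ x, N.totalArrivalRate x * y i x * N.P x j := by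
    simp only [Finset.mul_sum, Finset.sum_mul]
    rw [Finset.sum_comm]
    exact Finset.sum_congr rfl fun i _ => Finset.sum_congr rfl fun x _ => by ring
  simp only [h1]
  rw [h2, Finset.mul_sum, ← Finset.sum_sub_distrib, Finset.mul_sum]
  exact Finset.sum_congr rfl fun i _ => by ring

theorem meanArrival_nonneg (j : J) : 0 ≤ N.meanArrival j :=
  integral_nonneg fun _ => Nat.cast_nonneg _

/-- The traffic equation. -/
theorem meanArrival_eq (j : J) :
    N.meanArrival j = N.totalArrivalRate j - ∑ i, N.totalArrivalRate i * N.P i j := by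
  have h : Matrix.vecMul N.totalArrivalRate (1 - N.P) = N.meanArrival := by
    rw [totalArrivalRate, Matrix.vecMul_vecMul,
      Matrix.nonsing_inv_mul _ ((Matrix.isUnit_iff_isUnit_det _).mp N.isOpenNetwork),
      Matrix.vecMul_one]
  rw [← congrFun h j, Matrix.vecMul_sub, Matrix.vecMul_one]
  rfl

/-- By the traffic equation, twice the form is a sum of squares weighted by external arrivals, by
departures from the network and by internal flows. If it vanishes, y is constant along routes and
zero where jobs can leave, so (I - P) y = 0 and y = 0 by invertibility. -/
theorem driftForm_self_pos (hpos : ∀ j, 0 < N.totalArrivalRate j) {y : J → ℝ} (hy : y ≠ 0) :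
    0 < N.driftForm y y := by
  set l := N.totalArrivalRate with hl
  have hid : 2 * N.driftForm y y = ∑ j, N.meanArrival j * y j ^ 2 +
      ∑ i, l i * (1 - ∑ j, N.P i j) * y i ^ 2 + ∑ i, ∑ j, l i * N.P i j * (y i - y j) ^ 2 := by
    have e1 : ∑ j, N.meanArrival j * y j ^ 2 =
        ∑ j, l j * y j ^ 2 - ∑ i, ∑ j, l i * N.P i j * y j ^ 2 := by
      rw [Finset.sum_comm, ← Finset.sum_sub_distrib]
      refine Finset.sum_congr rfl fun j _ => ?_
      rw [meanArrival_eq, sub_mul, Finset.sum_mul]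
    have e2 : ∑ i, l i * (1 - ∑ j, N.P i j) * y i ^ 2 =
        ∑ j, l j * y j ^ 2 - ∑ i, ∑ j, l i * N.P i j * y i ^ 2 := by
      rw [← Finset.sum_sub_distrib]
      refine Finset.sum_congr rfl fun i _ => ?_
      simp only [← Finset.sum_mul, ← Finset.mul_sum]
      ring
    have e3 : ∑ i, ∑ j, l i * N.P i j * (y i - y j) ^ 2 =
        ∑ i, ∑ j, l i * N.P i j * y i ^ 2 + ∑ i, ∑ j, l i * N.P i j * y j ^ 2 -
          2 * ∑ i, ∑ j, y j * (l i * y i * N.P i j) := by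
      simp only [Finset.mul_sum, ← Finset.sum_add_distrib, ← Finset.sum_sub_distrib]
      exact Finset.sum_congr rfl fun i _ => Finset.sum_congr rfl fun j _ => by ring
    have e4 : N.driftForm y y =
        ∑ j, l j * y j ^ 2 - ∑ i, ∑ j, y j * (l i * y i * N.P i j) := by
      rw [Finset.sum_comm, ← Finset.sum_sub_distrib]
      refine Finset.sum_congr rfl fun j _ => ?_
      rw [mul_sub, Finset.mul_sum]
      ring
    rw [e1, e2, e3, e4]
    ring
  have n1 : 0 ≤ ∑ j, N.meanArrival j * y j ^ 2 :=
    Finset.sum_nonneg fun j _ => mul_nonneg (N.meanArrival_nonneg j) (sq_nonneg _)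
  have p2 : ∀ i, 0 ≤ l i * (1 - ∑ j, N.P i j) * y i ^ 2 := fun i =>
    mul_nonneg (mul_nonneg (hpos i).le (by linarith [N.P_row_sum_le i])) (sq_nonneg _)
  have n2 := Finset.sum_nonneg fun i (_ : i ∈ Finset.univ) => p2 i
  have p3 : ∀ i j, 0 ≤ l i * N.P i j * (y i - y j) ^ 2 := fun i j =>
    mul_nonneg (mul_nonneg (hpos i).le (N.P_nonneg i j)) (sq_nonneg _)
  have n3 := Finset.sum_nonneg fun i (_ : i ∈ Finset.univ) =>
    Finset.sum_nonneg fun j (_ : j ∈ Finset.univ) => p3 i j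
  by_contra! hle
  have z2 := (Finset.sum_eq_zero_iff_of_nonneg fun i _ => p2 i).mp
    (show ∑ i, l i * (1 - ∑ j, N.P i j) * y i ^ 2 = 0 by linarith)
  have z3 := (Finset.sum_eq_zero_iff_of_nonneg fun i _ =>
    Finset.sum_nonneg fun j (_ : j ∈ Finset.univ) => p3 i j).mp
    (show ∑ i, ∑ j, l i * N.P i j * (y i - y j) ^ 2 = 0 by linarith)
  have hker : Matrix.mulVec (1 - N.P) y = 0 := by
    ext i
    rw [Matrix.sub_mulVec, Matrix.one_mulVec, Pi.sub_apply, Pi.zero_apply]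
    have h2 : (1 - ∑ j, N.P i j) * y i = 0 := by
      rcases mul_eq_zero.mp (z2 i (Finset.mem_univ i)) with h | h
      · rw [(mul_eq_zero.mp h).resolve_left (hpos i).ne', zero_mul]
      · rw [pow_eq_zero_iff two_ne_zero] at h
        rw [h, mul_zero]
    have h3 : ∀ j, N.P i j * y j = N.P i j * y i := by
      intro j
      have := (Finset.sum_eq_zero_iff_of_nonneg fun j _ => p3 i j).mp
        (z3 i (Finset.mem_univ i)) j (Finset.mem_univ j)
      rcases mul_eq_zero.mp this with h | h
      · rw [(mul_eq_zero.mp h).resolve_left (hpos i).ne', zero_mul, zero_mul]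
      · rw [pow_eq_zero_iff two_ne_zero, sub_eq_zero] at h
        rw [h]
    have h4 : Matrix.mulVec N.P y i = (∑ j, N.P i j) * y i := by
      rw [Finset.sum_mul]
      exact Finset.sum_congr rfl fun j _ => h3 j
    rw [h4]
    linarith
  have hinj := Matrix.mulVec_injective_iff_isUnit.mpr N.isOpenNetwork
  exact hy (hinj (by rw [hker, Matrix.mulVec_zero]))

section Subcritical

variable {N} (hρ : N.trafficIntensity ∈ N.subcriticalRegion)
include hρ

open Filter Topology in
theorem exists_perturbation_mem (y : J → ℝ) :
    ∃ ε : ℝ, 0 < ε ∧ N.trafficIntensity + ε • y ∈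
      convexHull ℝ ((fun (σ : J → ℕ) (j : J) => (σ j : ℝ)) '' N.schedules) := by
  have hc : Continuous fun ε : ℝ => N.trafficIntensity + ε • y := by fun_prop
  have h0 := hc.tendsto 0
  simp only [zero_smul, add_zero] at h0
  have hev := (h0.eventually (mem_interior_iff_mem_nhds.mp hρ)).filter_mono
    (nhdsWithin_le_nhds (s := Set.Ioi 0))
  obtain ⟨ε, hε, hε0⟩ := (hev.and self_mem_nhdsWithin).exists
  exact ⟨ε, hε0, hε⟩

/-- The hull lies in the nonnegative orthant and still contains a point with smaller j-th
coordinate. -/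
theorem trafficIntensity_pos (j : J) : 0 < N.trafficIntensity j := by
  obtain ⟨ε, hε, hmem⟩ := exists_perturbation_mem hρ (-Pi.single j 1)
  have hsub : convexHull ℝ ((fun (σ : J → ℕ) (j : J) => (σ j : ℝ)) '' N.schedules) ⊆
      {x | 0 ≤ x j} := by
    refine convexHull_min ?_ ?_
    · rintro _ ⟨σ, _, rfl⟩
      exact Nat.cast_nonneg (α := ℝ) (σ j)
    · intro x hx y hy a b ha hb _
      exact add_nonneg (mul_nonneg ha hx) (mul_nonneg hb hy)
  have h := hsub hmem
  simp only [smul_neg, Set.mem_ofPred_eq, Pi.add_apply, Pi.neg_apply, Pi.smul_apply,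
    Pi.single_eq_same, smul_eq_mul, mul_one] at h
  linarith

theorem totalArrivalRate_pos (j : J) : 0 < N.totalArrivalRate j := by
  have h := trafficIntensity_pos hρ j
  rw [trafficIntensity] at h
  have := mul_pos h (N.p_pos j)
  rwa [div_mul_cancel₀ _ (N.p_pos j).ne'] at this

theorem schedules_nonempty : N.schedules.Nonempty := by
  obtain ⟨_, _, hmem⟩ := exists_perturbation_mem hρ 0
  by_contra! h
  rw [h, Set.image_empty, convexHull_empty] at hmem
  exact hmem

/-- The maximal excess grows linearly. -/
theorem exists_excess_ge : ∃ ε > 0, ∀ (q : J → ℕ) (g : ℝ),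
    (∀ σ ∈ N.schedules, ∑ j, (q j : ℝ) * N.excess σ j ≤ g) → ε * ∑ j, (q j : ℝ) ≤ g := by
  -- At the point (1 + ε) ρ of the hull the affine functional extending the excess payoff equals ε ∑
  -- q_j, while on the hull it is at most g.
  obtain ⟨ε, hε, hmem⟩ := exists_perturbation_mem hρ N.trafficIntensity
  refine ⟨ε, hε, fun q g hg => ?_⟩
  have hsub : convexHull ℝ ((fun (σ : J → ℕ) (j : J) => (σ j : ℝ)) '' N.schedules) ⊆
      {x | ∑ j, (q j : ℝ) * (x j / N.trafficIntensity j - 1) ≤ g} := by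
    refine convexHull_min ?_ ?_
    · rintro _ ⟨σ, hσ, rfl⟩
      exact hg σ hσ
    · intro x hx y hy a b ha hb hab
      rw [Set.mem_ofPred_eq] at hx hy ⊢
      calc _ = ∑ j, (a * ((q j : ℝ) * (x j / N.trafficIntensity j - 1)) +
              b * ((q j : ℝ) * (y j / N.trafficIntensity j - 1))) := by
            refine Finset.sum_congr rfl fun j _ => ?_
            simp only [Pi.add_apply, Pi.smul_apply, smul_eq_mul]
            have : (a * x j + b * y j) / N.trafficIntensity j - 1 =
              a * (x j / N.trafficIntensity j - 1) + b * (y j / N.trafficIntensity j - 1) := by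
              rw [add_div, mul_div_assoc, mul_div_assoc]
              linear_combination hab
            rw [this]
            ring
        _ ≤ a * g + b * g := by
            rw [Finset.sum_add_distrib, ← Finset.mul_sum, ← Finset.mul_sum]
            gcongr
        _ = g := by rw [← add_mul, hab, one_mul]
  have h := hsub hmem
  rw [Set.mem_ofPred_eq] at h
  rw [Finset.mul_sum]
  refine le_trans (le_of_eq (Finset.sum_congr rfl fun j _ => ?_)) h
  simp only [Pi.add_apply, Pi.smul_apply, smul_eq_mul]
  have := (trafficIntensity_pos hρ j).ne'
  field_simp
  ring

/-- The Lyapunov function. -/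
theorem exists_lyapunov (hfin : N.schedules.Finite) :
    ∃ δ > 0, ∃ C ≥ 0, ∀ η ≥ 0, ∃ (V : (J → ℕ) → ℝ) (R C' : ℝ), 0 ≤ C' ∧
      (∀ q, V q ≤ C' * (1 + ∑ j, (q j : ℝ))) ∧
      ∀ q : J → ℕ, R ≤ ∑ j, (q j : ℝ) → 0 ≤ V q ∧ ∃ v : J → ℝ, (∀ j, |v j| ≤ C) ∧
        (∀ x : J → ℕ, V q - V x ≤ ∑ j, v j * ((q j : ℝ) - x j)) ∧
        ∀ σ ∈ N.schedules, (∀ τ ∈ N.schedules, ∑ j, (q j : ℝ) * N.excess τ j ≤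
          ∑ j, (q j : ℝ) * N.excess σ j + η) → δ ≤ N.driftForm v (N.excess σ) := by
  classical
  have : Fintype N.schedules := hfin.fintype
  have hne : Nonempty N.schedules := (schedules_nonempty hρ).to_subtype
  -- A common q with positive payoffs prevents any convex combination of the excesses in F from
  -- vanishing, which makes the game on F strictly copositive.
  set Fam : Set (Finset N.schedules) :=
    {F | F.Nonempty ∧ ∃ q : J → ℝ, ∀ σ ∈ F, 0 < ∑ j, q j * N.excess σ j} with hFam
  have hstrat : ∀ F : Finset N.schedules, F ∈ Fam → ∃ α : N.schedules → ℝ,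
      (∀ σ ∈ F, 0 < α σ) ∧ ∑ σ ∈ F, α σ = 1 ∧
      ∀ τ ∈ F, 0 < N.driftForm (fun j => ∑ σ ∈ F, α σ * N.excess σ j) (N.excess τ) := by
    rintro F ⟨hF, q, hq⟩
    have : Nonempty F := hF.to_subtype
    obtain ⟨α, hα0, hα1, hα⟩ := exists_fullSupport_strategy (ι := F)
      (fun σ τ => N.driftForm (N.excess σ) (N.excess τ)) (by
        intro β hβ
        have e : ∑ i : F, ∑ k : F, β i * β k * N.driftForm (N.excess i) (N.excess k) =
            N.driftForm (fun j => ∑ i : F, β i * N.excess i j)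
              (fun j => ∑ i : F, β i * N.excess i j) := by
          rw [driftForm_sum_left]
          refine Finset.sum_congr rfl fun i _ => ?_
          rw [driftForm_sum_right, Finset.mul_sum]
          exact Finset.sum_congr rfl fun k _ => by ring
        rw [e]
        refine N.driftForm_self_pos (totalArrivalRate_pos hρ) fun h0 => ?_
        have h1 : ∑ j, q j * (∑ i : F, β i * N.excess i j) = 0 :=
          Finset.sum_eq_zero fun j _ => by rw [congrFun h0 j]; simp
        have h2 : ∑ j, q j * (∑ i : F, β i * N.excess i j) =
            ∑ i : F, β i * ∑ j, q j * N.excess i j := by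
          simp only [Finset.mul_sum]
          rw [Finset.sum_comm]
          exact Finset.sum_congr rfl fun i _ => Finset.sum_congr rfl fun j _ => by ring
        have h3 := (Finset.sum_eq_zero_iff_of_nonneg fun i _ =>
          mul_nonneg (hβ.1 i) (hq i i.2).le).mp (h2.symm.trans h1)
        have h4 : ∀ i : F, β i = 0 := fun i =>
          (mul_eq_zero.mp (h3 i (Finset.mem_univ i))).resolve_right (hq i i.2).ne'
        have h5 := hβ.2
        simp [h4] at h5)
    refine ⟨fun σ => if h : σ ∈ F then α ⟨σ, h⟩ else 0, fun σ hσ => ?_, ?_, fun τ hτ => ?_⟩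
    · simp only [dif_pos hσ]; exact hα0 _
    · rw [← Finset.sum_coe_sort]
      simpa using hα1
    · have h := hα ⟨τ, hτ⟩
      rw [← driftForm_sum_left] at h
      convert h using 2
      ext j
      rw [← Finset.sum_coe_sort]
      simp
  choose! α hαpos hαsum hαdrift using hstrat
  -- There are finitely many pairs (F, σ), so the weights, and below the drifts, have a positive
  -- lower bound that does not involve η.
  obtain ⟨w, hw, hwα⟩ := exists_pos_forall_le
    (ι := {p : Finset N.schedules × N.schedules // p.1 ∈ Fam ∧ p.2 ∈ p.1})
    (f := fun p => α p.1.1 p.1.2) fun p => hαpos _ p.2.1 _ p.2.2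
  set v : Finset N.schedules → J → ℝ := fun F j => ∑ σ ∈ F, α F σ * N.excess σ j with hv
  obtain ⟨δ, hδ, hδv⟩ := exists_pos_forall_le
    (ι := {p : Finset N.schedules × N.schedules // p.1 ∈ Fam ∧ p.2 ∈ p.1})
    (f := fun p => N.driftForm (v p.1.1) (N.excess p.1.2)) fun p => hαdrift _ p.2.1 _ p.2.2
  set C : ℝ := ∑ F : Finset N.schedules, ∑ j, |v F j| with hC
  have hC0 : 0 ≤ C := Finset.sum_nonneg fun F _ => Finset.sum_nonneg fun j _ => abs_nonneg _
  have hvC : ∀ F j, |v F j| ≤ C := fun F j =>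
    (Finset.single_le_sum (f := fun j => |v F j|) (fun j _ => abs_nonneg _)
      (Finset.mem_univ j)).trans
    (Finset.single_le_sum (f := fun F => ∑ j, |v F j|)
      (fun F _ => Finset.sum_nonneg fun j _ => abs_nonneg _) (Finset.mem_univ F))
  refine ⟨δ, hδ, C, hC0, fun η hη => ?_⟩
  obtain ⟨M, K, hMmono, hM0, hK0, hM⟩ := exists_bonus (ι := N.schedules) hw hη
  obtain ⟨ε, hε, hεg⟩ := exists_excess_ge hρ
  set V : (J → ℕ) → ℝ := fun q =>
    ⨆ F : Fam, ∑ j, v F j * (q j : ℝ) + M (F : Finset N.schedules).card with hV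
  have hMn : ∀ F : Finset N.schedules, M F.card ≤ M (Fintype.card N.schedules) := fun F =>
    hMmono (Finset.card_le_univ F)
  have hMnn : ∀ n, 0 ≤ M n := fun n => hM0.trans (hMmono (Nat.zero_le n))
  -- Beyond this radius the maximal payoff is at least K + 1, so schedules within K of the maximum
  -- have positive payoff and every nonempty set of them is in `Fam`.
  refine ⟨V, (K + 1) / ε, C + M (Fintype.card N.schedules), add_nonneg hC0 (hMnn _),
    fun q => ?_, fun q hq => ?_⟩
  · have hq0 : 0 ≤ ∑ j, (q j : ℝ) := Finset.sum_nonneg fun j _ => Nat.cast_nonneg _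
    have hM' := hMnn (Fintype.card N.schedules)
    -- The nonnegativity of the bound covers an empty `Fam`, for which the supremum is 0.
    refine Real.iSup_le (fun F => ?_) (by positivity)
    have h1 : ∑ j, v F j * (q j : ℝ) ≤ C * ∑ j, (q j : ℝ) := by
      rw [Finset.mul_sum]
      exact Finset.sum_le_sum fun j _ => mul_le_mul_of_nonneg_right
        ((le_abs_self _).trans (hvC F j)) (Nat.cast_nonneg _)
    nlinarith [hMn F.1, mul_nonneg hM' hq0]
  · set z : N.schedules → ℝ := fun σ => ∑ j, (q j : ℝ) * N.excess σ j with hz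
    obtain ⟨σ₀, hσ₀⟩ := Finite.exists_max z
    have hgK : K + 1 ≤ z σ₀ := by
      have h1 := hεg q (z σ₀) fun σ hσ => hσ₀ ⟨σ, hσ⟩
      rw [div_le_iff₀ hε] at hq
      linarith
    have hFamz : ∀ F : Finset N.schedules, F.Nonempty → (∀ i ∈ F, z σ₀ - K ≤ z i) → F ∈ Fam :=
      fun F hF h => ⟨hF, fun j => (q j : ℝ), fun σ hσ => by have := h σ hσ; simp only [hz] at *; linarith⟩
    have hval : ∀ F : Finset N.schedules,
        ∑ j, v F j * (q j : ℝ) = ∑ σ ∈ F, α F σ * z σ := by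
      intro F
      simp only [hv, hz, Finset.sum_mul, Finset.mul_sum]
      rw [Finset.sum_comm]
      exact Finset.sum_congr rfl fun i _ => Finset.sum_congr rfl fun j _ => by ring
    have hsing : ({σ₀} : Finset N.schedules) ∈ Fam :=
      hFamz _ (Finset.singleton_nonempty _) fun i hi => by
        rw [Finset.mem_singleton.mp hi]; linarith
    have : Nonempty Fam := ⟨⟨_, hsing⟩⟩
    have hbdd : ∀ x : J → ℕ, BddAbove (Set.range fun F : Fam =>
        ∑ j, v F j * (x j : ℝ) + M (F : Finset N.schedules).card) := fun x => (Set.finite_range _).bddAbove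
    obtain ⟨F, hF⟩ := exists_eq_ciSup_of_finite
      (f := fun F : Fam => ∑ j, v F j * (q j : ℝ) + M (F : Finset N.schedules).card)
    have hmax : ∀ F' ∈ Fam, ∑ j, v F' j * (q j : ℝ) + M F'.card ≤
        ∑ j, v F j * (q j : ℝ) + M (F : Finset N.schedules).card := fun F' hF' => by
      rw [hF]; exact le_ciSup (hbdd q) ⟨F', hF'⟩
    refine ⟨?_, v F, hvC F, fun x => ?_, fun σ hσ hgap => ?_⟩
    · have h1 := le_ciSup (hbdd q) ⟨_, hsing⟩
      have hα1 : α {σ₀} σ₀ = 1 := by simpa using hαsum _ hsing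
      have h2 : ∑ j, v {σ₀} j * (q j : ℝ) = z σ₀ := by
        rw [hval, Finset.sum_singleton, hα1, one_mul]
      have h3 : z σ₀ + M ({σ₀} : Finset N.schedules).card ≤ V q := h2 ▸ h1
      linarith [hMnn ({σ₀} : Finset N.schedules).card]
    · have h1 := le_ciSup (hbdd x) F
      have h2 : V q = ∑ j, v F j * (q j : ℝ) + M (F : Finset N.schedules).card := hF.symm
      have h3 : ∑ j, v F j * ((q j : ℝ) - x j) =
          ∑ j, v F j * (q j : ℝ) - ∑ j, v F j * (x j : ℝ) := by
        rw [← Finset.sum_sub_distrib]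
        exact Finset.sum_congr rfl fun j _ => by ring
      have h4 : ∑ j, v F j * (x j : ℝ) + M (F : Finset N.schedules).card ≤ V x := h1
      linarith
    -- A schedule within η of optimal belongs to the maximizing F, and v F has drift at least δ
    -- against all members of F.
    · have hmem : (⟨σ, hσ⟩ : N.schedules) ∈ (F : Finset N.schedules) := by
        refine hM Fam α (fun F hF => ⟨hαsum F hF, fun i hi => hwα ⟨(F, i), hF, hi⟩⟩) z σ₀ hσ₀ hFamz
          F F.2 (fun F' hF' => ?_) ⟨σ, hσ⟩ ?_
        · rw [← hval, ← hval]; exact hmax F' hF'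
        · have := hgap σ₀ σ₀.2
          simp only [hz]
          linarith
      exact hδv ⟨(F, ⟨σ, hσ⟩), F.2, hmem⟩

end Subcritical

end SwitchedNetwork

/-! ### Pathwise estimates and moments of the fluctuations -/

namespace SwitchedNetwork

variable {J : Type*} [Fintype J] [DecidableEq J] {N : SwitchedNetwork J}

/-- A maximizer exists almost surely for the queue length vector with a single job at j, which
bounds the j-th coordinate over all schedules. -/
theorem finite_schedules_of_policy {Ω : Type*} [MeasurableSpace Ω] {μ : Measure Ω}
    [IsProbabilityMeasure μ] {X : Primitives J Ω} (hpolicy : X.IsWeightedMaxWeightPolicy N μ)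
    (hpos : ∀ j, 0 < N.trafficIntensity j) : N.schedules.Finite := by
  have h : ∀ j, ∃ c : ℕ, ∀ σ ∈ N.schedules, σ j ≤ c := by
    intro j
    obtain ⟨ω, hω⟩ := (hpolicy 0 (Pi.single j 1)).exists
    refine ⟨X.rule 0 ω (Pi.single j 1) j, fun σ hσ => ?_⟩
    have h1 := hω.1 hσ
    simp only [Pi.single_apply, Nat.cast_ite, Nat.cast_one, Nat.cast_zero, ite_mul, one_mul,
      zero_mul, Finset.sum_ite_eq', Finset.mem_univ, if_true, Set.mem_ofPred_eq] at h1
    rw [div_le_div_iff_of_pos_right (hpos j)] at h1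
    exact_mod_cast h1
  choose c hc using h
  exact (Set.finite_Iic c).subset fun σ hσ j => hc j σ hσ

theorem P_le_one (N : SwitchedNetwork J) (i j : J) : N.P i j ≤ 1 :=
  (Finset.single_le_sum (f := fun j => N.P i j) (fun j _ => N.P_nonneg i j)
    (Finset.mem_univ j)).trans (N.P_row_sum_le i)

namespace Primitives

variable {Ω : Type*} (X : Primitives J Ω) (N)

/-- The deviations of the arrivals, service completions and routing decisions from their means. -/
noncomputable def fluctuation (c T : ℕ) (ω : Ω) : ℝ :=
  ∑ j, |(X.cumArrival ω j T : ℝ) - T * N.meanArrival j| +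
    ∑ j, maxAbs (fun u => (X.cumServed ω j u : ℝ) - u * N.p j) (c * T) +
    ∑ i, ∑ j, maxAbs (fun u => (X.cumRouted ω i j u : ℝ) - u * N.P i j) (c * T)

section Pathwise

variable {N X} {ω : Ω} {x : J → ℕ} {q : ℕ → J → ℕ} {c : ℕ}

theorem cumServed_mono (j : J) : Monotone (X.cumServed ω j) := fun _ _ h =>
  Finset.card_le_card (Finset.filter_subset_filter _ (Finset.range_mono h))

theorem cumRouted_mono (i j : J) : Monotone (X.cumRouted ω i j) := fun _ _ h =>
  Finset.card_le_card (Finset.filter_subset_filter _ (Finset.range_mono h))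

theorem cumRouted_le (i j : J) (d : ℕ) : X.cumRouted ω i j d ≤ d :=
  (Finset.card_filter_le _ _).trans (by simp)

theorem cumArrival_mono (j : J) : Monotone (X.cumArrival ω j) := fun _ _ h =>
  Finset.sum_le_sum_of_subset (Finset.range_mono h)

theorem cumWork_mono (j : J) : Monotone (X.cumWork ω q j) := fun _ _ h =>
  Finset.sum_le_sum_of_subset (Finset.range_mono h)

theorem departures_mono (j : J) : Monotone (X.departures ω q j) :=
  (cumServed_mono j).comp (cumWork_mono j)

theorem departures_le_cumWork (j : J) (t : ℕ) : X.departures ω q j t ≤ X.cumWork ω q j t :=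
  (Finset.card_filter_le _ _).trans (Finset.card_range _).le

variable (hmax : ∀ t q, N.IsWeightedMaxWeightSchedule q (X.rule t ω q))
include hmax

theorem work_mem_schedules (t : ℕ) :
    (fun j => min (X.rule t ω (q t) j) (q t j)) ∈ N.schedules :=
  N.schedules_lower _ (hmax t (q t)).2 _ fun _ => min_le_left _ _

/-- The work actually done is nearly optimal. -/
theorem excess_le_work (hpos : ∀ j, 0 < N.trafficIntensity j) (hc : ∀ σ ∈ N.schedules, ∀ j, σ j ≤ c)
    (t : ℕ) {τ : J → ℕ} (hτ : τ ∈ N.schedules) :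
    ∑ j, (q t j : ℝ) * N.excess τ j ≤
      ∑ j, (q t j : ℝ) * N.excess (fun j => min (X.rule t ω (q t) j) (q t j)) j +
        ∑ j, (c : ℝ) * c / N.trafficIntensity j := by
  have h1 : ∑ j, (q t j : ℝ) * ((τ j : ℝ) / N.trafficIntensity j) ≤
      ∑ j, (q t j : ℝ) * ((X.rule t ω (q t) j : ℝ) / N.trafficIntensity j) := (hmax t (q t)).1 hτ
  have h2 : ∀ j, (q t j : ℝ) * ((X.rule t ω (q t) j : ℝ) / N.trafficIntensity j) ≤
      (q t j : ℝ) * (((min (X.rule t ω (q t) j) (q t j) : ℕ) : ℝ) / N.trafficIntensity j) +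
        (c : ℝ) * c / N.trafficIntensity j := by
    intro j
    rw [← mul_div_assoc, ← mul_div_assoc, ← add_div, div_le_div_iff_of_pos_right (hpos j)]
    have hr := hc _ (hmax t (q t)).2 j
    have : q t j * X.rule t ω (q t) j ≤ q t j * min (X.rule t ω (q t) j) (q t j) + c * c := by
      -- Work is lost only when the queue is shorter than the offered service, hence at most c.
      rcases le_total (X.rule t ω (q t) j) (q t j) with h | h
      · rw [min_eq_left h]; omega
      · exact (Nat.mul_le_mul (h.trans hr) hr).trans (Nat.le_add_left _ _)
    exact_mod_cast this
  have h3 := Finset.sum_le_sum fun j (_ : j ∈ Finset.univ) => h2 j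
  rw [Finset.sum_add_distrib] at h3
  simp only [excess, mul_sub, mul_one, Finset.sum_sub_distrib]
  linarith

theorem cumWork_le (hc : ∀ σ ∈ N.schedules, ∀ j, σ j ≤ c) (j : J) (T : ℕ) :
    X.cumWork ω q j T ≤ c * T := by
  calc X.cumWork ω q j T ≤ ∑ _t ∈ Finset.range T, c :=
        Finset.sum_le_sum fun t _ => hc _ (work_mem_schedules hmax t) j
    _ = c * T := by simp [mul_comm]

theorem departures_le (hc : ∀ σ ∈ N.schedules, ∀ j, σ j ≤ c) (j : J) (T : ℕ) :
    X.departures ω q j T ≤ c * T :=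
  (departures_le_cumWork j T).trans (cumWork_le hmax hc j T)

variable (hbal : ∀ t j, (q t j : ℤ) = (x j : ℤ) + X.totalArrivals ω q j t - X.departures ω q j t)
include hbal

omit hmax in
theorem balance_real (t : ℕ) (j : J) : (q t j : ℝ) = x j + X.cumArrival ω j t +
    ∑ i, (X.cumRouted ω i j (X.departures ω q i t) : ℝ) - X.departures ω q j t := by
  have h := congrArg (fun n : ℤ => (n : ℝ)) (hbal t j)
  simp only [totalArrivals] at h
  push_cast at h
  linarith

theorem sub_le_queue (hc : ∀ σ ∈ N.schedules, ∀ j, σ j ≤ c) (T : ℕ) (j : J) :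
    (x j : ℝ) - c * T ≤ q T j := by
  rw [balance_real hbal]
  have h1 : (X.departures ω q j T : ℝ) ≤ c * T := by exact_mod_cast departures_le hmax hc j T
  have h2 : 0 ≤ ∑ i, (X.cumRouted ω i j (X.departures ω q i T) : ℝ) :=
    Finset.sum_nonneg fun i _ => Nat.cast_nonneg _
  have h3 : (0 : ℝ) ≤ X.cumArrival ω j T := Nat.cast_nonneg _
  linarith

theorem abs_queue_sub_le (hc : ∀ σ ∈ N.schedules, ∀ j, σ j ≤ c) {t T : ℕ} (ht : t ≤ T) (j : J) :
    |(q T j : ℝ) - q t j| ≤ X.cumArrival ω j T + (Fintype.card J + 1) * (c * T) := by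
  rw [balance_real hbal T, balance_real hbal t]
  have hcT : (0 : ℝ) ≤ c * T := by positivity
  have hd : ∀ i, (X.departures ω q i T : ℝ) ≤ c * T := fun i => by
    exact_mod_cast departures_le hmax hc i T
  have hdm : (X.departures ω q j t : ℝ) ≤ X.departures ω q j T := by
    exact_mod_cast departures_mono j ht
  have hd0 : (0 : ℝ) ≤ X.departures ω q j t := Nat.cast_nonneg _
  have he : (X.cumArrival ω j t : ℝ) ≤ X.cumArrival ω j T := by
    exact_mod_cast cumArrival_mono j ht
  have he0 : (0 : ℝ) ≤ X.cumArrival ω j t := Nat.cast_nonneg _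
  have hr0 : 0 ≤ ∑ i, (X.cumRouted ω i j (X.departures ω q i t) : ℝ) :=
    Finset.sum_nonneg fun i _ => Nat.cast_nonneg _
  have hr : ∑ i, (X.cumRouted ω i j (X.departures ω q i t) : ℝ) ≤
      ∑ i, (X.cumRouted ω i j (X.departures ω q i T) : ℝ) :=
    Finset.sum_le_sum fun i _ => by exact_mod_cast cumRouted_mono i j (departures_mono i ht)
  have hr1 : ∑ i, (X.cumRouted ω i j (X.departures ω q i T) : ℝ) ≤ Fintype.card J * (c * T) := by
    calc _ ≤ ∑ _i : J, (c * T : ℝ) := Finset.sum_le_sum fun i _ =>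
          (by exact_mod_cast cumRouted_le i j _ : _ ≤ (X.departures ω q i T : ℝ)).trans (hd i)
      _ = _ := by simp
  have := hd j
  rw [abs_le]
  constructor <;> nlinarith

/-- The displacement of the queue lengths, up to fluctuations, is the one given by the mean rates. -/
theorem abs_queue_sub_add_le (hpos : ∀ j, 0 < N.trafficIntensity j)
    (hc : ∀ σ ∈ N.schedules, ∀ j, σ j ≤ c) (T : ℕ) (j : J) :
    |(q T j : ℝ) - x j + ∑ t ∈ Finset.range T, (N.totalArrivalRate j *
      N.excess (fun j => min (X.rule t ω (q t) j) (q t j)) j - ∑ i, N.totalArrivalRate i *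
      N.excess (fun j => min (X.rule t ω (q t) j) (q t j)) i * N.P i j)| ≤
      2 * X.fluctuation N c T ω := by
  set y : ℕ → J → ℝ := fun t => N.excess (fun j => min (X.rule t ω (q t) j) (q t j)) with hy
  have hwork : ∀ i, N.p i * X.cumWork ω q i T =
      ∑ t ∈ Finset.range T, N.totalArrivalRate i * y t i + T * N.totalArrivalRate i := by
    intro i
    have hp : N.totalArrivalRate i = N.trafficIntensity i * N.p i := by
      rw [trafficIntensity, div_mul_cancel₀ _ (N.p_pos i).ne']
    have hk : (T : ℝ) * N.totalArrivalRate i =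
        ∑ _t ∈ Finset.range T, N.totalArrivalRate i := by simp
    rw [hk, ← Finset.sum_add_distrib, cumWork, Nat.cast_sum, Finset.mul_sum]
    refine Finset.sum_congr rfl fun t _ => ?_
    have := (hpos i).ne'
    simp only [hy, excess]
    rw [hp]
    field_simp
    ring
  set E := (X.cumArrival ω j T : ℝ) - T * N.meanArrival j
  set S : J → ℝ := fun i => X.departures ω q i T - X.cumWork ω q i T * N.p i with hS
  set F : J → ℝ := fun i => X.cumRouted ω i j (X.departures ω q i T) -
    X.departures ω q i T * N.P i j with hF
  -- The mean rates cancel by the traffic equation; what remains are the centred arrivals, routings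
  -- and services, the services appearing both as departures and through routing, whence the factor
  -- 2.
  have hid : (q T j : ℝ) - x j + ∑ t ∈ Finset.range T, (N.totalArrivalRate j * y t j -
      ∑ i, N.totalArrivalRate i * y t i * N.P i j) =
      E + ∑ i, F i + ∑ i, N.P i j * S i - S j := by
    rw [balance_real hbal T, Finset.sum_sub_distrib, Finset.sum_comm]
    have e1 : ∑ i, ∑ t ∈ Finset.range T, N.totalArrivalRate i * y t i * N.P i j =
        ∑ i, (N.p i * X.cumWork ω q i T * N.P i j) -
          T * ∑ i, N.totalArrivalRate i * N.P i j := by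
      rw [Finset.mul_sum, ← Finset.sum_sub_distrib]
      refine Finset.sum_congr rfl fun i _ => ?_
      rw [hwork, ← Finset.sum_mul]
      ring
    have e2 : ∑ i, F i + ∑ i, N.P i j * S i =
        ∑ i, (X.cumRouted ω i j (X.departures ω q i T) : ℝ) -
          ∑ i, (N.p i * X.cumWork ω q i T * N.P i j) := by
      rw [← Finset.sum_add_distrib, ← Finset.sum_sub_distrib]
      refine Finset.sum_congr rfl fun i _ => ?_
      simp only [hS, hF]
      ring
    have e3 := N.meanArrival_eq j
    have e4 := hwork j
    rw [e1, add_assoc E, e2]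
    simp only [E, hS]
    rw [e3]
    linarith
  rw [hid]
  have hSb : ∀ i, |S i| ≤ maxAbs (fun u => (X.cumServed ω i u : ℝ) - u * N.p i) (c * T) := fun i =>
    abs_le_maxAbs (fun u => (X.cumServed ω i u : ℝ) - u * N.p i) (cumWork_le hmax hc i T)
  have hFb : ∀ i, |F i| ≤ maxAbs (fun u => (X.cumRouted ω i j u : ℝ) - u * N.P i j) (c * T) :=
    fun i => abs_le_maxAbs (fun u => (X.cumRouted ω i j u : ℝ) - u * N.P i j)
      (departures_le hmax hc i T)
  set a := ∑ j, |(X.cumArrival ω j T : ℝ) - T * N.meanArrival j|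
  set s := ∑ j, maxAbs (fun u => (X.cumServed ω j u : ℝ) - u * N.p j) (c * T)
  set r := ∑ i, ∑ j, maxAbs (fun u => (X.cumRouted ω i j u : ℝ) - u * N.P i j) (c * T)
  have b1 : |E| ≤ a := Finset.single_le_sum
    (f := fun j => |(X.cumArrival ω j T : ℝ) - T * N.meanArrival j|)
    (fun _ _ => abs_nonneg _) (Finset.mem_univ j)
  have b2 : |S j| ≤ s := (hSb j).trans (Finset.single_le_sum
    (f := fun j => maxAbs (fun u => (X.cumServed ω j u : ℝ) - u * N.p j) (c * T))
    (fun _ _ => maxAbs_nonneg _ _) (Finset.mem_univ j))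
  have b3 : |∑ i, F i| ≤ r := (Finset.abs_sum_le_sum_abs _ _).trans
    (Finset.sum_le_sum fun i _ => (hFb i).trans (Finset.single_le_sum
      (f := fun j => maxAbs (fun u => (X.cumRouted ω i j u : ℝ) - u * N.P i j) (c * T))
      (fun _ _ => maxAbs_nonneg _ _) (Finset.mem_univ j)))
  have b4 : |∑ i, N.P i j * S i| ≤ s := (Finset.abs_sum_le_sum_abs _ _).trans
    (Finset.sum_le_sum fun i _ => by
      rw [abs_mul, abs_of_nonneg (N.P_nonneg i j)]
      exact (mul_le_of_le_one_left (abs_nonneg _) (N.P_le_one i j)).trans (hSb i))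
  have hfl : X.fluctuation N c T ω = a + s + r := rfl
  rw [hfl]
  have ha : 0 ≤ a := (abs_nonneg _).trans b1
  have hr : 0 ≤ r := (abs_nonneg _).trans b3
  rw [abs_le] at *
  constructor <;> linarith

end Pathwise

section Moments

open Filter Topology

variable {N X} [MeasurableSpace Ω] {μ : Measure Ω} [IsProbabilityMeasure μ]

theorem IsDriving.integrable_fluctuation (hX : X.IsDriving N μ) (c T : ℕ) :
    Integrable (X.fluctuation N c T) μ := by
  refine Integrable.add (Integrable.add ?_ ?_) ?_
  · exact integrable_finsetSum _ fun j _ =>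
      ((hX.integrable_cumArrival j T).sub (integrable_const _)).abs
  · exact integrable_finsetSum _ fun j _ => (hX.fluctuation_cumServed j).1 _
  · exact integrable_finsetSum _ fun i _ => integrable_finsetSum _ fun j _ =>
      (hX.fluctuation_cumRouted i j).1 _

theorem IsDriving.tendsto_fluctuation (hX : X.IsDriving N μ) {c : ℕ} (hc : 0 < c) :
    Tendsto (fun T : ℕ => (∫ ω, X.fluctuation N c T ω ∂μ) / T) atTop (𝓝 0) := by
  have hscale : ∀ {f : ℕ → ℝ}, Tendsto (fun n : ℕ => f n / n) atTop (𝓝 0) →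
      Tendsto (fun T : ℕ => f (c * T) / T) atTop (𝓝 0) := by
    intro f hf
    have h1 := (hf.comp (tendsto_id.const_mul_atTop' hc)).const_mul (c : ℝ)
    rw [mul_zero] at h1
    refine h1.congr fun T => ?_
    have : (c : ℝ) ≠ 0 := by exact_mod_cast hc.ne'
    simp only [Function.comp_apply, id_eq, Nat.cast_mul]
    rw [← mul_div_assoc, mul_div_mul_left _ _ this]
  have h1 : Tendsto (fun T : ℕ => ∑ j, (∫ ω, |(X.cumArrival ω j T : ℝ) -
      T * N.meanArrival j| ∂μ) / T) atTop (𝓝 (∑ _j : J, (0 : ℝ))) :=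
    tendsto_finsetSum _ fun j _ => hX.tendsto_cumArrival j
  have h2 : Tendsto (fun T : ℕ => ∑ j, (∫ ω, maxAbs (fun u => (X.cumServed ω j u : ℝ) -
      u * N.p j) (c * T) ∂μ) / T) atTop (𝓝 (∑ _j : J, (0 : ℝ))) :=
    tendsto_finsetSum _ fun j _ => hscale (hX.fluctuation_cumServed j).2
  have h3 : Tendsto (fun T : ℕ => ∑ i, ∑ j, (∫ ω, maxAbs (fun u => (X.cumRouted ω i j u : ℝ) -
      u * N.P i j) (c * T) ∂μ) / T) atTop (𝓝 (∑ _i : J, ∑ _j : J, (0 : ℝ))) :=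
    tendsto_finsetSum _ fun i _ => tendsto_finsetSum _ fun j _ =>
      hscale (hX.fluctuation_cumRouted i j).2
  have h := (h1.add h2).add h3
  simp only [Finset.sum_const_zero, add_zero] at h
  refine h.congr fun T => ?_
  have i1 : ∀ j, Integrable (fun ω => |(X.cumArrival ω j T : ℝ) - T * N.meanArrival j|) μ :=
    fun j => ((hX.integrable_cumArrival j T).sub (integrable_const _)).abs
  have i2 := fun j => (hX.fluctuation_cumServed j).1 (c * T)
  have i3 := fun i j => (hX.fluctuation_cumRouted i j).1 (c * T)
  simp only [fluctuation]
  rw [integral_add, integral_add, integral_finsetSum _ fun j _ => i1 j,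
    integral_finsetSum _ fun j _ => i2 j,
    integral_finsetSum _ fun i _ => integrable_finsetSum _ fun j _ => i3 i j]
  · simp only [integral_finsetSum _ fun j (_ : j ∈ Finset.univ) => i3 _ j, Finset.sum_div, add_div]
  · exact integrable_finsetSum _ fun j _ => i1 j
  · exact integrable_finsetSum _ fun j _ => i2 j
  · exact (integrable_finsetSum _ fun j _ => i1 j).add (integrable_finsetSum _ fun j _ => i2 j)
  · exact integrable_finsetSum _ fun i _ => integrable_finsetSum _ fun j _ => i3 i j

end Moments

end Primitives

end SwitchedNetwork

/-! ### The drift over T steps and the conclusion -/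

namespace SwitchedNetwork

variable {J : Type*} [Fintype J] [DecidableEq J] {N : SwitchedNetwork J}

namespace Primitives

variable {Ω : Type*} {X : Primitives J Ω}

/-- With v a subgradient at the end point, one vector serves for all times before T, and it is
tested against schedules that are nearly optimal for q T because the queues cannot have moved far.
The part η of the gap covers the work lost in short queues and twice the effect of this movement. -/
theorem lyapunov_sub_le {ω : Ω} {x : J → ℕ} {q : ℕ → J → ℕ} {c : ℕ}
    (hmax : ∀ t q, N.IsWeightedMaxWeightSchedule q (X.rule t ω q))
    (hbal : ∀ t j, (q t j : ℤ) = (x j : ℤ) + X.totalArrivals ω q j t - X.departures ω q j t)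
    (hpos : ∀ j, 0 < N.trafficIntensity j) (hc : ∀ σ ∈ N.schedules, ∀ j, σ j ≤ c) {T : ℕ}
    {v : J → ℝ} {δ C B Y η κ d : ℝ} (hδ : 0 < δ) (hvC : ∀ j, |v j| ≤ C) (hC : 0 ≤ C)
    (hB : ∀ σ ∈ N.schedules, ∑ j, |N.totalArrivalRate j * N.excess σ j -
      ∑ i, N.totalArrivalRate i * N.excess σ i * N.P i j| ≤ B)
    (hY0 : 0 ≤ Y)
    (hY : ∀ σ ∈ N.schedules, ∀ j, |N.excess σ j| ≤ Y) (hκ : 0 < κ)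
    (hη : ∑ j, (c : ℝ) * c / N.trafficIntensity j +
      2 * Y * (κ + Fintype.card J * ((Fintype.card J + 1) * (c * T))) ≤ η)
    (hgap : ∀ σ ∈ N.schedules, (∀ τ ∈ N.schedules, ∑ j, (q T j : ℝ) * N.excess τ j ≤
          ∑ j, (q T j : ℝ) * N.excess σ j + η) → δ ≤ N.driftForm v (N.excess σ))
    (hd : d ≤ ∑ j, v j * ((q T j : ℝ) - x j)) :
    d ≤ -δ * T + (δ + C * B) * T * ((∑ j, (X.cumArrival ω j T : ℝ)) / κ) +
      C * (Fintype.card J * (2 * X.fluctuation N c T ω)) := by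
  set w : ℕ → J → ℕ := fun t j => min (X.rule t ω (q t) j) (q t j) with hw
  have hwS : ∀ t, w t ∈ N.schedules := fun t => work_mem_schedules hmax t
  set L : ℕ → J → ℝ := fun t j => N.totalArrivalRate j * N.excess (w t) j -
      ∑ i, N.totalArrivalRate i * N.excess (w t) i * N.P i j with hL
  have hform : ∀ t, N.driftForm v (N.excess (w t)) = ∑ j, v j * L t j := fun t => rfl
  have hB0 : 0 ≤ B := (Finset.sum_nonneg fun j _ => abs_nonneg _).trans (hB _ (hwS 0))
  have habs : ∀ f : J → ℝ, |∑ j, v j * f j| ≤ C * ∑ j, |f j| := by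
    intro f
    rw [Finset.mul_sum]
    refine (Finset.abs_sum_le_sum_abs _ _).trans (Finset.sum_le_sum fun j _ => ?_)
    rw [abs_mul]
    exact mul_le_mul_of_nonneg_right (hvC j) (abs_nonneg _)
  have hsplit : ∑ j, v j * ((q T j : ℝ) - x j) =
      ∑ j, v j * ((q T j : ℝ) - x j + ∑ t ∈ Finset.range T, L t j) -
        ∑ t ∈ Finset.range T, N.driftForm v (N.excess (w t)) := by
    simp only [hform]
    rw [Finset.sum_comm, ← Finset.sum_sub_distrib]
    refine Finset.sum_congr rfl fun j _ => ?_
    rw [← Finset.mul_sum]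
    ring
  have hnoise : ∑ j, v j * ((q T j : ℝ) - x j + ∑ t ∈ Finset.range T, L t j) ≤
      C * (Fintype.card J * (2 * X.fluctuation N c T ω)) := by
    refine (le_abs_self _).trans ((habs _).trans (mul_le_mul_of_nonneg_left ?_ hC))
    calc _ ≤ ∑ _j : J, 2 * X.fluctuation N c T ω :=
          Finset.sum_le_sum fun j _ => abs_queue_sub_add_le hmax hbal hpos hc T j
      _ = _ := by simp
  set e := ∑ j, (X.cumArrival ω j T : ℝ) with he
  have he0 : 0 ≤ e := Finset.sum_nonneg fun j _ => Nat.cast_nonneg _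
  have hT0 : (0 : ℝ) ≤ T := Nat.cast_nonneg T
  have hdrift : δ * T - (δ + C * B) * T * (e / κ) ≤
      ∑ t ∈ Finset.range T, N.driftForm v (N.excess (w t)) := by
    have hCB : 0 ≤ C * B := mul_nonneg hC hB0
    have hconst : ∀ r : ℝ, (∀ t ∈ Finset.range T, r ≤ N.driftForm v (N.excess (w t))) →
        T * r ≤ ∑ t ∈ Finset.range T, N.driftForm v (N.excess (w t)) := by
      intro r hr
      calc (T : ℝ) * r = ∑ _t ∈ Finset.range T, r := by simp
        _ ≤ _ := Finset.sum_le_sum hr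
    -- With at most κ arrivals every step has drift at least δ. Otherwise only the bound -C B is
    -- available, and e / κ > 1 makes the penalty term absorb the difference.
    rcases le_or_gt e κ with hek | hek
    · have h1 := hconst δ fun t ht => by
        have htT : t ≤ T := (Finset.mem_range.mp ht).le
        refine hgap _ (hwS t) fun τ hτ => ?_
        have hclose : ∀ σ ∈ N.schedules, |∑ j, (q T j : ℝ) * N.excess σ j -
            ∑ j, (q t j : ℝ) * N.excess σ j| ≤ Y * ∑ j, |(q T j : ℝ) - q t j| := by
          intro σ hσ
          rw [← Finset.sum_sub_distrib, Finset.mul_sum]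
          refine (Finset.abs_sum_le_sum_abs _ _).trans (Finset.sum_le_sum fun j _ => ?_)
          rw [← sub_mul, abs_mul, mul_comm]
          exact mul_le_mul_of_nonneg_right (hY σ hσ j) (abs_nonneg _)
        have hdist : ∑ j, |(q T j : ℝ) - q t j| ≤
            κ + Fintype.card J * ((Fintype.card J + 1) * (c * T)) := by
          calc _ ≤ ∑ j, ((X.cumArrival ω j T : ℝ) + (Fintype.card J + 1) * (c * T)) :=
                Finset.sum_le_sum fun j _ => abs_queue_sub_le hmax hbal hc htT j
            _ = e + Fintype.card J * ((Fintype.card J + 1) * (c * T)) := by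
                rw [Finset.sum_add_distrib]
                simp [he]
            _ ≤ _ := by linarith
        have k1 := abs_le.mp (hclose τ hτ)
        have k2 := abs_le.mp (hclose (w t) (hwS t))
        have k3 : ∑ j, (q t j : ℝ) * N.excess τ j ≤ ∑ j, (q t j : ℝ) * N.excess (w t) j +
            ∑ j, (c : ℝ) * c / N.trafficIntensity j := excess_le_work hmax hpos hc t hτ
        have k4 : Y * ∑ j, |(q T j : ℝ) - q t j| ≤
            Y * (κ + Fintype.card J * ((Fintype.card J + 1) * (c * T))) :=
          mul_le_mul_of_nonneg_left hdist hY0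
        linarith
      have : 0 ≤ (δ + C * B) * T * (e / κ) := by positivity
      linarith
    · have h1 := hconst (-(C * B)) fun t _ => by
        rw [hform]
        have := (abs_le.mp (habs (L t))).1
        have h2 : C * ∑ j, |L t j| ≤ C * B := mul_le_mul_of_nonneg_left (hB _ (hwS t)) hC
        linarith
      have h3 : 1 ≤ e / κ := by rw [le_div_iff₀ hκ]; linarith
      have h4 : (δ + C * B) * T * 1 ≤ (δ + C * B) * T * (e / κ) := by gcongr
      linarith
  linarith

end Primitives

/-- Weighted MaxWeight is maximally stable. -/
theorem isPositiveRecurrent_of_weightedMaxWeight {Ω : Type*} [MeasurableSpace Ω] {μ : Measure Ω}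
    [IsProbabilityMeasure μ] {X : Primitives J Ω} (hX : X.IsDriving N μ)
    (hρ : N.trafficIntensity ∈ N.subcriticalRegion) (hpolicy : X.IsWeightedMaxWeightPolicy N μ)
    {Q : (J → ℕ) → ℕ → Ω → J → ℕ} (hQ : ∀ x, X.IsQueueingNetworkSolution x (Q x)) :
    IsPositiveRecurrent μ Q := by
  have hpos := trafficIntensity_pos hρ
  have hfin := finite_schedules_of_policy hpolicy hpos
  have hmc := hX.isMarkovChain hQ
  obtain ⟨c, hc0, hc⟩ : ∃ c : ℕ, 0 < c ∧ ∀ σ ∈ N.schedules, ∀ j, σ j ≤ c := by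
    -- The added 1 makes c positive, as required when limits are taken along multiples of c.
    refine ⟨∑ σ ∈ hfin.toFinset, ∑ j, σ j + 1, Nat.succ_pos _, fun σ hσ j => ?_⟩
    have h1 : σ j ≤ ∑ j, σ j := Finset.single_le_sum (fun _ _ => Nat.zero_le _) (Finset.mem_univ j)
    have h2 : ∑ j, σ j ≤ ∑ σ ∈ hfin.toFinset, ∑ j, σ j :=
      Finset.single_le_sum (f := fun σ : J → ℕ => ∑ j, σ j) (fun _ _ => Nat.zero_le _)
        (by simpa using hσ)
    omega
  obtain ⟨B, hB0, hB⟩ : ∃ B : ℝ, 0 ≤ B ∧ ∀ σ ∈ N.schedules,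
      ∑ j, |N.totalArrivalRate j * N.excess σ j -
        ∑ i, N.totalArrivalRate i * N.excess σ i * N.P i j| ≤ B :=
    ⟨∑ σ ∈ hfin.toFinset, ∑ j, |N.totalArrivalRate j * N.excess σ j -
        ∑ i, N.totalArrivalRate i * N.excess σ i * N.P i j|,
      Finset.sum_nonneg fun _ _ => Finset.sum_nonneg fun _ _ => abs_nonneg _, fun σ hσ =>
      Finset.single_le_sum (f := fun σ : J → ℕ => ∑ j, |N.totalArrivalRate j * N.excess σ j -
        ∑ i, N.totalArrivalRate i * N.excess σ i * N.P i j|)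
        (fun _ _ => Finset.sum_nonneg fun _ _ => abs_nonneg _) (by simpa using hσ)⟩
  obtain ⟨Y, hY0, hY⟩ : ∃ Y : ℝ, 0 ≤ Y ∧ ∀ σ ∈ N.schedules, ∀ j, |N.excess σ j| ≤ Y :=
    ⟨∑ σ ∈ hfin.toFinset, ∑ j, |N.excess σ j|,
      Finset.sum_nonneg fun _ _ => Finset.sum_nonneg fun _ _ => abs_nonneg _, fun σ hσ j =>
      (Finset.single_le_sum (f := fun j => |N.excess σ j|) (fun _ _ => abs_nonneg _)
        (Finset.mem_univ j)).trans
      (Finset.single_le_sum (f := fun σ : J → ℕ => ∑ j, |N.excess σ j|)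
        (fun _ _ => Finset.sum_nonneg fun _ _ => abs_nonneg _) (by simpa using hσ))⟩
  obtain ⟨δ, hδ, C, hC0, hlyap⟩ := exists_lyapunov hρ hfin
  have hae : ∀ᵐ ω ∂μ, ∀ t q, N.IsWeightedMaxWeightSchedule q (X.rule t ω q) := by
    rw [ae_all_iff]
    exact fun t => ae_all_iff.mpr (hpolicy t)
  set m : ℝ := (Fintype.card J : ℝ) with hm
  have hm0 : 0 ≤ m := Nat.cast_nonneg _
  -- T depends only on δ and C; then κ depends on T, η on κ and T, and finally V on η. This order is
  -- possible because δ and C do not depend on η.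
  obtain ⟨T, hTfl, hTδ⟩ : ∃ T : ℕ, C * (m * (2 * ∫ ω, X.fluctuation N c T ω ∂μ)) ≤ δ * T / 4 ∧
      4 ≤ δ * T := by
    have h1 := ((hX.tendsto_fluctuation hc0).const_mul (2 * C * m))
    rw [mul_zero] at h1
    have h2 := h1.eventually (gt_mem_nhds (show (0 : ℝ) < δ / 4 by positivity))
    have h3 := (tendsto_natCast_atTop_atTop (R := ℝ)).eventually_ge_atTop (4 / δ)
    obtain ⟨T, hT1, hT2⟩ := (h2.and h3).exists
    rw [div_le_iff₀ hδ] at hT2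
    have hT0 : (0 : ℝ) < T := by
      by_contra! h
      nlinarith
    refine ⟨T, ?_, by linarith⟩
    rw [← mul_div_assoc, div_lt_iff₀ hT0] at hT1
    linarith
  have hT0 : (0 : ℝ) ≤ T := Nat.cast_nonneg T
  set a : ℝ := ∑ j, N.meanArrival j with ha
  have ha0 : 0 ≤ a := Finset.sum_nonneg fun j _ => N.meanArrival_nonneg j
  set G : ℝ := δ + C * B with hG
  have hG0 : 0 < G := by positivity
  -- The mean number of arrivals is T a, so this κ makes the mean penalty for exceptional arrivals
  -- at most δ T / 4.
  set κ : ℝ := 4 * G * T * (a + 1) / δ + 1 with hκ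
  have hκ0 : 0 < κ := by positivity
  have hκG : G * T * (T * a / κ) ≤ δ * T / 4 := by
    rw [← mul_div_assoc, div_le_iff₀ hκ0]
    have : δ * κ = 4 * G * T * (a + 1) + δ := by
      rw [hκ]; field_simp
    nlinarith [mul_nonneg (mul_nonneg hG0.le hT0) hT0, mul_nonneg hδ.le hT0]
  set η : ℝ := ∑ j, (c : ℝ) * c / N.trafficIntensity j +
      2 * Y * (κ + m * ((m + 1) * (c * T))) with hη
  have hη0 : 0 ≤ η := add_nonneg
    (Finset.sum_nonneg fun j _ => div_nonneg (by positivity) (hpos j).le) (by positivity)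
  obtain ⟨V, R, C', hC'0, hVle, hV⟩ := hlyap η hη0
  have hcumint : ∀ n, Integrable (fun ω => ∑ j, (X.cumArrival ω j n : ℝ)) μ := fun n =>
    integrable_finsetSum _ fun j _ => hX.integrable_cumArrival j n
  have hsumint : ∀ n, ∫ ω, ∑ j, (X.cumArrival ω j n : ℝ) ∂μ = n * a := fun n => by
    rw [integral_finsetSum _ fun j _ => hX.integrable_cumArrival j n, ha, Finset.mul_sum]
    exact Finset.sum_congr rfl fun j _ => hX.integral_cumArrival j n
  -- Each queue loses at most c T jobs by time T, so outside `K` the total queue length at time T is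
  -- still at least R.
  set K : Set (J → ℕ) := {x | ∑ j, (x j : ℝ) < R + m * (c * T)} with hK
  have hKfin : K.Finite := by
    refine (Set.finite_Iic fun _ : J => ⌈R + m * (c * T)⌉₊).subset fun x hx j => ?_
    have h1 : (x j : ℝ) ≤ ∑ j, (x j : ℝ) := Finset.single_le_sum (f := fun j => (x j : ℝ))
      (fun _ _ => Nat.cast_nonneg _) (Finset.mem_univ j)
    have h2 : (x j : ℝ) ≤ ⌈R + m * (c * T)⌉₊ := (h1.trans (le_of_lt hx)).trans (Nat.le_ceil _)
    exact_mod_cast h2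
  refine hmc.isPositiveRecurrent_of_finite hKfin fun x =>
    hmc.meanReturnTime_lt_top_of_multistep_drift (V := fun q => ENNReal.ofReal (V q)) (T := T)
      (fun n x => ?_) (fun x hx => ?_) x
  · have hint : Integrable (fun ω => C' * (1 + ((∑ j, (x j : ℝ) + m * ((m + 1) * (c * n))) +
        ∑ j, (X.cumArrival ω j n : ℝ)))) μ :=
      ((integrable_const _).add ((integrable_const _).add (hcumint n))).const_mul _
    refine lt_of_le_of_lt (lintegral_mono_ae ?_) hint.lintegral_lt_top
    filter_upwards [hae] with ω hω
    refine ENNReal.ofReal_le_ofReal ((hVle _).trans ?_)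
    gcongr
    calc ∑ j, (Q x n ω j : ℝ) ≤ ∑ j, ((x j : ℝ) +
          ((X.cumArrival ω j n : ℝ) + (m + 1) * (c * n))) := by
          refine Finset.sum_le_sum fun j _ => ?_
          have h1 := Primitives.abs_queue_sub_le hω ((hQ x).balance · ω) hc (Nat.zero_le n) j
          rw [(hQ x).init] at h1
          linarith [(abs_le.mp h1).2]
      _ = _ := by
          rw [Finset.sum_add_distrib, Finset.sum_add_distrib]
          simp [hm]
          ring
  · have hx : R + m * (c * T) ≤ ∑ j, (x j : ℝ) := not_lt.mp hx
    have hmcT : 0 ≤ m * (c * T) := by positivity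
    have hVx : 0 ≤ V x := (hV x (by linarith)).1
    set D : Ω → ℝ := fun ω => -δ * T + G * T * ((∑ j, (X.cumArrival ω j T : ℝ)) / κ) +
      C * (m * (2 * X.fluctuation N c T ω)) with hD
    have hi1 : Integrable (fun ω => G * T * ((∑ j, (X.cumArrival ω j T : ℝ)) / κ)) μ :=
      ((hcumint T).div_const _).const_mul _
    have hi2 : Integrable (fun ω => C * (m * (2 * X.fluctuation N c T ω))) μ :=
      (((hX.integrable_fluctuation c T).const_mul _).const_mul _).const_mul _
    have hi3 : Integrable (fun ω => -δ * T + G * T * ((∑ j, (X.cumArrival ω j T : ℝ)) / κ)) μ :=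
      (integrable_const _).add hi1
    have hDint : Integrable D μ := hi3.add hi2
    -- The fluctuations and the exceptional arrivals each cost at most a quarter of δ T, and δ T ≥
    -- 4.
    have hDle : ∫ ω, D ω ∂μ ≤ -1 := by
      have : ∫ ω, D ω ∂μ = -δ * T + G * T * (T * a / κ) +
          C * (m * (2 * ∫ ω, X.fluctuation N c T ω ∂μ)) := by
        rw [hD, integral_add hi3 hi2, integral_add (integrable_const _) hi1]
        simp only [integral_const_mul, integral_div, hsumint]
        simp
      rw [this]
      linarith
    have hpath : ∀ᵐ ω ∂μ, 0 ≤ V (Q x T ω) ∧ V (Q x T ω) ≤ V x + D ω := by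
      filter_upwards [hae] with ω hω
      have hbig : R ≤ ∑ j, (Q x T ω j : ℝ) := by
        have h1 : ∑ j, ((x j : ℝ) - c * T) ≤ ∑ j, (Q x T ω j : ℝ) :=
          Finset.sum_le_sum fun j _ => Primitives.sub_le_queue hω ((hQ x).balance · ω) hc T j
        rw [Finset.sum_sub_distrib] at h1
        simp only [Finset.sum_const, Finset.card_univ, nsmul_eq_mul] at h1
        linarith
      obtain ⟨h0, v, hvC, hvx, hvgap⟩ := hV _ hbig
      refine ⟨h0, ?_⟩
      have := Primitives.lyapunov_sub_le hω ((hQ x).balance · ω) hpos hc hδ hvC hC0 hB hY0 hY hκ0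
        hη.ge hvgap (hvx x)
      simp only [hD]
      linarith
    have hVD : Integrable (fun ω => V x + D ω) μ := (integrable_const _).add hDint
    have hVD0 : 0 ≤ᵐ[μ] fun ω => V x + D ω := by
      filter_upwards [hpath] with ω hω using hω.1.trans hω.2
    have hle : ∫⁻ ω, ENNReal.ofReal (V (Q x T ω)) ∂μ ≤ ENNReal.ofReal (V x - 1) := by
      calc _ ≤ ∫⁻ ω, ENNReal.ofReal (V x + D ω) ∂μ := lintegral_mono_ae (by
            filter_upwards [hpath] with ω hω using ENNReal.ofReal_le_ofReal hω.2)
        _ = ENNReal.ofReal (∫ ω, (V x + D ω) ∂μ) :=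
            (ofReal_integral_eq_lintegral_ofReal hVD hVD0).symm
        _ ≤ _ := by
            refine ENNReal.ofReal_le_ofReal ?_
            rw [integral_add (integrable_const _) hDint]
            simp only [integral_const, probReal_univ, smul_eq_mul, one_mul]
            linarith
    -- A nonnegative random variable has mean at most V x - 1. This rules out truncation by
    -- `ENNReal.ofReal`, which would spoil the drift inequality.
    have hV1 : 0 ≤ V x - 1 := by
      have h1 := integral_nonneg_of_ae hVD0
      rw [integral_add (integrable_const _) hDint] at h1
      simp only [integral_const, probReal_univ, smul_eq_mul, one_mul] at h1
      linarith
    calc _ ≤ ENNReal.ofReal (V x - 1) + 1 := by gcongr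
      _ = ENNReal.ofReal (V x) := by
          rw [← ENNReal.ofReal_one, ← ENNReal.ofReal_add hV1 zero_le_one]
          congr 1
          ring

end SwitchedNetwork

/-- For a single class switched network with an arbitrary set of schedules and an arbitrary mean
routing matrix, under the weighted MaxWeight policy, if the traffic intensity is in the subcritical
region then the queueing network process is positive recurrent. Here `Q x` is the process started
at the state `x`. -/
theorem theorem2 {J : Type*} [Fintype J] [DecidableEq J] (N : SwitchedNetwork J)
    (hρ : N.trafficIntensity ∈ N.subcriticalRegion)
    {Ω : Type*} [MeasurableSpace Ω] (μ : Measure Ω) [IsProbabilityMeasure μ]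
    (X : SwitchedNetwork.Primitives J Ω) (hX : X.IsDriving N μ)
    (hpolicy : X.IsWeightedMaxWeightPolicy N μ)
    (Q : (J → ℕ) → ℕ → Ω → J → ℕ) (hQ : ∀ x, X.IsQueueingNetworkSolution x (Q x)) :
    IsPositiveRecurrent μ Q := by
  exact SwitchedNetwork.isPositiveRecurrent_of_weightedMaxWeight hX hρ hpolicy hQ
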